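/- A combinatorial pseudo-triangulation is a combinatorial embedding in the plane of a finite connected planar simple graph (a rotation system of genus $0$ with one face chosen as the outer face), together with an assignment of tags reflex/convex to its angles, such that (i) every interior face has exactly three angles tagged convex, (ii) all angles of the outer face are tagged reflex, and (iii) no vertex is incident to more than one angle tagged reflex. A combinatorial 4-PPT is a combinatorial pseudo-triangulation in which every vertex is incident to an angle tagged reflex and every interior face has at most four boundary edges, counted with multiplicity. A face is degenerate if some edge appears twice on its boundary; a $k$-face is a face whose boundary walk has length $k$. Let $T$ be a combinatorial 4-PPT, let $\triangle$ be an interior triangular face of $T$, and let $e$ be an edge of $\triangle$ that is not an edge of the outer face. Let $F$ be the face on the other side of $e$. A (valid) flip of $e$ replaces $e$ by another edge $e'$ that is not an edge of $T$, drawn inside the face $(\triangle\cup F)\setminus e$ obtained by removing $e$, such that $e'$ splits this face into a triangular face and a face of the same size as $F$, nothing changes outside this face (neither the embedding nor the tags nor the outer face), and the result, with suitable tags on the angles inside the face, is again a combinatorial 4-PPT. Then $e$ is flippable, i.e. there is at least one flip of $e$. Furthermore: 1. If removing $e$ results in a $4$-face or in a degenerate $5$-face, then there is exactly one flip of $e$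 (the resulting combinatorial 4-PPT, tags included, is unique). 2. If removing $e$ results in a non-degenerate $5$-face, then there are at least two flips of $e$, with different new edges $e'$. -/

import Mathlib

/-- A finite simple graph together with a cyclic order of the neighbours around every vertex
(a rotation system, i.e. a combinatorial embedding of the graph in an oriented surface).
`rot v w` is the neighbour of `v` that follows `w` in the clockwise order around `v`; off the
neighbours of `v` the permutation `rot v` is the identity, so that equal embeddings are equal
as terms. -/
@[ext]
structure RotationSystem (V : Type*) where
  graph : SimpleGraph V
  rot : V → Equiv.Perm V
  rot_isCycleOn : ∀ v, (rot v).IsCycleOn (graph.neighborSet v)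
  rot_of_not_adj : ∀ v w, ¬ graph.Adj v w → rot v w = w

/-- The permutation `f` with the element `w` cut out of its cycle (and made a fixed point). -/
def permErase {V : Type*} [DecidableEq V] (f : Equiv.Perm V) (w : V) : Equiv.Perm V :=
  Equiv.swap w (f w) * f

theorem permErase_self {V : Type*} [DecidableEq V] (f : Equiv.Perm V) (w : V) :
    permErase f w w = w := by
  simp [permErase]

theorem permErase_of_eq {V : Type*} [DecidableEq V] (f : Equiv.Perm V) {w x : V}
    (hx : f x = w) : permErase f w x = f w := by
  simp [permErase, hx]

theorem permErase_of_ne {V : Type*} [DecidableEq V] (f : Equiv.Perm V) {w x : V}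
    (hxw : x ≠ w) (hx : f x ≠ w) : permErase f w x = f x := by
  have h : f x ≠ f w := fun h => hxw (f.injective h)
  simp [permErase, Equiv.swap_apply_of_ne_of_ne hx h]

theorem permErase_sameCycle {V : Type*} [DecidableEq V] (f : Equiv.Perm V) (w : V) (n : ℕ) :
    ∀ x, x ≠ w → (f ^ n) x ≠ w → (permErase f w).SameCycle x ((f ^ n) x) := by
  induction n using Nat.strong_induction_on with
  | _ n ih =>
    intro x hxw hn
    match n, ih, hn with
    | 0, _, _ => exact Equiv.Perm.SameCycle.refl _ _
    | 1, _, hn =>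
      have h1 : permErase f w x = (f ^ 1) x := permErase_of_ne f hxw (by simpa using hn)
      rw [← h1]
      exact Equiv.Perm.sameCycle_apply_right.2 (Equiv.Perm.SameCycle.refl _ _)
    | k + 2, ih, hn =>
      by_cases hx : f x = w
      · have hfw : f w ≠ w := fun h => hxw (f.injective (hx.trans h.symm))
        have e : (f ^ (k + 2)) x = (f ^ k) (f w) := by
          rw [pow_add, Equiv.Perm.mul_apply, pow_two, Equiv.Perm.mul_apply, hx]
        rw [e] at hn ⊢
        have h2 := ih k (by omega) (f w) hfw hn
        rw [← permErase_of_eq f hx] at h2 ⊢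
        exact Equiv.Perm.sameCycle_apply_left.1 h2
      · have e : (f ^ (k + 2)) x = (f ^ (k + 1)) (f x) := by
          rw [pow_succ f (k + 1), Equiv.Perm.mul_apply]
        rw [e] at hn ⊢
        have h2 := ih (k + 1) (by omega) (f x) hx hn
        rw [← permErase_of_ne f hxw hx] at h2 ⊢
        exact Equiv.Perm.sameCycle_apply_left.1 h2

theorem permErase_isCycleOn {V : Type*} [DecidableEq V] {f : Equiv.Perm V} {s : Set V}
    (hf : f.IsCycleOn s) (w : V) : (permErase f w).IsCycleOn (s \ {w}) := by
  refine ⟨⟨?_, (permErase f w).injective.injOn, ?_⟩, ?_⟩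
  · rintro x ⟨hxs, hxw⟩
    have hxw : x ≠ w := hxw
    by_cases hx : f x = w
    · rw [permErase_of_eq f hx]
      exact ⟨hf.1.mapsTo (hx ▸ hf.1.mapsTo hxs),
        fun h => hxw (f.injective (hx.trans (show f w = w from h).symm))⟩
    · rw [permErase_of_ne f hxw hx]
      exact ⟨hf.1.mapsTo hxs, hx⟩
  · rintro y ⟨hys, hyw⟩
    have hyw : y ≠ w := hyw
    obtain ⟨x, hxs, rfl⟩ := hf.1.surjOn hys
    by_cases hxw : x = w
    · subst hxw
      obtain ⟨z, hzs, hz⟩ := hf.1.surjOn hxs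
      refine ⟨z, ⟨hzs, ?_⟩, permErase_of_eq f hz⟩
      rintro rfl
      exact hyw hz
    · exact ⟨x, ⟨hxs, hxw⟩, permErase_of_ne f hxw hyw⟩
  · rintro x ⟨hxs, hxw⟩ y ⟨hys, hyw⟩
    obtain ⟨i, hi⟩ := hf.2 hxs hys
    obtain ⟨n, rfl | rfl⟩ := i.eq_nat_or_neg
    · rw [zpow_natCast] at hi
      subst hi
      exact permErase_sameCycle f w n x hxw hyw
    · rw [zpow_neg, zpow_natCast, Equiv.Perm.inv_eq_iff_eq] at hi
      subst hi
      exact (permErase_sameCycle f w n y hyw hxw).symm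

namespace RotationSystem

variable {V : Type*}

/-- A directed edge (dart) is a pair `p = (u, v)` of adjacent vertices. It is followed, on the
boundary of the face to its left, by the dart `(v, rot v u)`. -/
def facePerm (M : RotationSystem V) : Equiv.Perm (V × V) where
  toFun p := (p.2, M.rot p.2 p.1)
  invFun p := ((M.rot p.1).symm p.2, p.1)
  left_inv p := by simp
  right_inv p := by simp

/-- The face to the left of the dart `p`, given as the set of all darts on its boundary that
have it on their left. The dart `(u, v)` also stands for the angle of this face at `v` that lies
between the edges `uv` and `v (rot v u)`, so that the elements of a face are its angles, too. -/
def faceOf (M : RotationSystem V) (p : V × V) : Set (V × V) :=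
  {q | M.facePerm.SameCycle p q}

def faces (M : RotationSystem V) : Set (Set (V × V)) :=
  {S | ∃ p : V × V, M.graph.Adj p.1 p.2 ∧ S = M.faceOf p}

/-- The surface is a sphere: the graph is connected and Euler's formula holds. -/
def IsPlanar (M : RotationSystem V) : Prop :=
  M.graph.Connected ∧ Nat.card V + M.faces.ncard = M.graph.edgeSet.ncard + 2

/-- The embedding obtained by removing the edge that joins `p.1` and `p.2`. -/
def deleteEdge [DecidableEq V] (M : RotationSystem V) (p : V × V) : RotationSystem V where
  graph := M.graph.deleteEdges {s(p.1, p.2)}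
  rot v :=
    if v = p.1 then permErase (M.rot v) p.2
    else if v = p.2 then permErase (M.rot v) p.1
    else M.rot v
  rot_isCycleOn v := by
    split_ifs with h1 h2
    · have e : (M.graph.deleteEdges {s(p.1, p.2)}).neighborSet v
          = M.graph.neighborSet v \ {p.2} := by
        subst h1; ext w; simp; grind
      rw [e]
      exact permErase_isCycleOn (M.rot_isCycleOn v) _
    · have e : (M.graph.deleteEdges {s(p.1, p.2)}).neighborSet v
          = M.graph.neighborSet v \ {p.1} := by
        subst h2; ext w; simp; grind
      rw [e]
      exact permErase_isCycleOn (M.rot_isCycleOn v) _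
    · have e : (M.graph.deleteEdges {s(p.1, p.2)}).neighborSet v = M.graph.neighborSet v := by
        ext w; simp; grind
      rw [e]
      exact M.rot_isCycleOn v
  rot_of_not_adj v w h := by
    have key : ∀ x, (M.graph.Adj v w → w = x) → permErase (M.rot v) x w = w := by
      intro x hx
      by_cases hwx : w = x
      · subst hwx; exact permErase_self _ _
      · have hfix : M.rot v w = w := M.rot_of_not_adj v w fun h => hwx (hx h)
        rw [permErase_of_ne _ hwx (by rwa [hfix]), hfix]
    obtain ⟨a, b⟩ := p
    split_ifs with h1 h2
    · refine key _ fun hadj => ?_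
      subst h1; simp at h; grind
    · refine key _ fun hadj => ?_
      subst h2; simp at h; grind
    · refine M.rot_of_not_adj v w fun hadj => h ?_
      simp; grind

/-- The face that results from removing the edge of `p`, i.e. the union of the two faces on the
sides of `p`: the face of the remaining embedding that contains the dart following `p`. -/
def mergedFace [DecidableEq V] (M : RotationSystem V) (p : V × V) : Set (V × V) :=
  (M.deleteEdge p).faceOf (M.facePerm p)

end RotationSystem

/-- A face is degenerate if some edge appears twice on its boundary. -/
def IsDegenerateFace {V : Type*} (S : Set (V × V)) : Prop :=
  ∃ p ∈ S, p.swap ∈ S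

/-- A combinatorial embedding of a (connected) planar simple graph in the plane, given by an
embedding in the sphere with one face chosen as the outer face, together with an assignment of
tags reflex/convex to its angles: the angles in `reflex` are tagged reflex, all others convex. -/
@[ext]
structure TaggedPlaneGraph (V : Type*) extends RotationSystem V where
  isPlanar : toRotationSystem.IsPlanar
  outer : Set (V × V)
  outer_mem : outer ∈ toRotationSystem.faces
  reflex : Set (V × V)
  adj_of_mem_reflex : ∀ p ∈ reflex, graph.Adj p.1 p.2

namespace TaggedPlaneGraph

variable {V : Type*}

structure IsPseudoTriangulation (T : TaggedPlaneGraph V) : Prop where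
  three_convex : ∀ S ∈ T.faces, S ≠ T.outer → (S \ T.reflex).ncard = 3
  outer_reflex : T.outer ⊆ T.reflex
  reflex_unique : ∀ p ∈ T.reflex, ∀ q ∈ T.reflex, p.2 = q.2 → p = q

/-- Every vertex is incident to an angle tagged reflex. -/
def IsPointed (T : TaggedPlaneGraph V) : Prop :=
  ∀ v, ∃ p ∈ T.reflex, p.2 = v

/-- Combinatorial 4-PPTs. -/
structure Is4PPT (T : TaggedPlaneGraph V) : Prop where
  isPseudoTriangulation : T.IsPseudoTriangulation
  isPointed : T.IsPointed
  ncard_le_four : ∀ S ∈ T.faces, S ≠ T.outer → S.ncard ≤ 4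

/-- `T'` arises from `T` by a (valid) flip of the edge `e` of the dart `d`, where the face to the
left of `d` is the triangle and `F` is the face on the other side. Here `d'` is a dart of the new
edge `e'`, which is not an edge of `T`. Removing `e` from `T` and `e'` from `T'` leaves the same
embedding, and `e` and `e'` lie in the same face of it; `e'` splits this face into a triangle
and a face of the size of `F`. Nothing changes outside this face. -/
def IsFlip [DecidableEq V] (T : TaggedPlaneGraph V) (d : V × V) (T' : TaggedPlaneGraph V) :
    Prop :=
  T'.Is4PPT ∧ T'.outer = T.outer ∧
  (∀ S ∈ T.faces, S ≠ T.faceOf d → S ≠ T.faceOf d.swap →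
    ∀ p ∈ S, (p ∈ T'.reflex ↔ p ∈ T.reflex)) ∧
  ∃ d' : V × V, T'.graph.Adj d'.1 d'.2 ∧ ¬ T.graph.Adj d'.1 d'.2 ∧
    T'.deleteEdge d' = T.deleteEdge d ∧
    T'.mergedFace d' = T.mergedFace d ∧
    (T'.faceOf d').ncard = 3 ∧
    (T'.faceOf d'.swap).ncard = (T.faceOf d.swap).ncard

/-- The edge of the dart `d` (with the triangle on its left) is flippable. -/
def IsFlippable [DecidableEq V] (T : TaggedPlaneGraph V) (d : V × V) : Prop :=
  ∃ T', T.IsFlip d T'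

end TaggedPlaneGraph

/-! Removing e = ab from the triangle abc merges the triangle and F into a face P. The angles of the
triangle are convex and each merged angle takes its tag from F, so P has exactly four convex angles:
it is a 4-face without reflex angle or a 5-face with one (`IsOpened4PPT`). Conversely, a new edge uv
may be drawn in P when it cuts off an ear at a convex corner z whose neighbours u, v on P are
distinct and not adjacent. So the flips are such ears with a chord other than e, and it remains to
see which diagonals of P are already edges.

This is settled by counting. Let w be a convex corner of P with neighbours u, v, and suppose that uv
is an edge. The triangle uwv bounds a region S that avoids the outer face, with n inner vertices, m
inner edges and f faces. Euler gives m + 1 ≤ n + f, and S has at most 2m + 3 darts. A face with r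
reflex angles has at least 2r + 2 edges, be it an interior 3- or 4-face or P. Hence S has at most n
reflex angles. The inner vertices use them all up, so no corner has its reflex angle in S
(`IsRegion.corner_notMem`). At w this forces P into S. Then the reflex angle of P is neither at u
nor at v, and P is no 4-face: there the angle at w could be counted as reflex without violating the
bound (`exists_isRegion_of_chord`).

So both diagonals of a 4-face are free; one is e, the other is the unique flip. In a 5-face p₀…p₄
with reflex corner p₀, both diagonals at p₀ are free. If p₁ ≠ p₄, so is one of p₁p₃, p₂p₄, since
both could not be drawn outside P; at least two free diagonals differ from e. If P is degenerate, p₀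
is a leaf at p₁ = p₄ and only the diagonals at p₀ remain. Tags are forced in a 4-face (no reflex
angle) and at a leaf (its only angle is reflex).

The Jordan curve theorem and the Euler inequality come from homology modulo 2: for a connected
embedding with Euler's formula, every cycle is a boundary (`exists_faceBoundary_eq`). -/

namespace RotationSystem

variable {V : Type*}

/-! ### Faces as cycles of the face permutation -/

theorem facePerm_apply (M : RotationSystem V) (p : V × V) :
    M.facePerm p = (p.2, M.rot p.2 p.1) := rfl

theorem adj_rot_iff (M : RotationSystem V) {v w : V} :
    M.graph.Adj v (M.rot v w) ↔ M.graph.Adj v w := by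
  constructor
  · intro h
    by_contra hn
    rw [M.rot_of_not_adj v w hn] at h
    exact hn h
  · exact fun h => (M.rot_isCycleOn v).1.mapsTo h

theorem adj_facePerm_iff (M : RotationSystem V) {p : V × V} :
    M.graph.Adj (M.facePerm p).1 (M.facePerm p).2 ↔ M.graph.Adj p.1 p.2 := by
  rw [facePerm_apply, adj_rot_iff, SimpleGraph.adj_comm]

theorem mem_faceOf_self (M : RotationSystem V) (p : V × V) : p ∈ M.faceOf p :=
  Equiv.Perm.SameCycle.refl _ _

theorem facePerm_mem_faceOf_iff (M : RotationSystem V) {p q : V × V} :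
    M.facePerm q ∈ M.faceOf p ↔ q ∈ M.faceOf p :=
  Equiv.Perm.sameCycle_apply_right

theorem faceOf_eq_of_mem (M : RotationSystem V) {p q : V × V} (h : q ∈ M.faceOf p) :
    M.faceOf q = M.faceOf p := by
  ext x
  exact ⟨fun hx => Equiv.Perm.SameCycle.trans h hx,
    fun hx => Equiv.Perm.SameCycle.trans (Equiv.Perm.SameCycle.symm h) hx⟩

theorem mem_faceOf_iff_eq (M : RotationSystem V) {p q : V × V} :
    q ∈ M.faceOf p ↔ M.faceOf q = M.faceOf p :=
  ⟨M.faceOf_eq_of_mem, fun h => h ▸ M.mem_faceOf_self q⟩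

theorem faceOf_facePerm (M : RotationSystem V) (p : V × V) :
    M.faceOf (M.facePerm p) = M.faceOf p :=
  M.faceOf_eq_of_mem (M.facePerm_mem_faceOf_iff.2 (M.mem_faceOf_self p))

/-- Forward closure suffices because on a finite cycle every element is a nonnegative power away. -/
theorem faceOf_subset_of_mapsTo [Finite V] (M : RotationSystem V) {S : Set (V × V)}
    (hS : ∀ p ∈ S, M.facePerm p ∈ S) {p : V × V} (hp : p ∈ S) : M.faceOf p ⊆ S := by
  intro q hq
  obtain ⟨n, -, rfl⟩ := Equiv.Perm.SameCycle.exists_pow_eq' (f := M.facePerm) hq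
  induction n with
  | zero => simpa using hp
  | succ n ih =>
    rw [pow_succ', Equiv.Perm.mul_apply]
    refine hS _ (ih ?_)
    exact ⟨n, by simp⟩

theorem adj_of_mem_faceOf [Finite V] (M : RotationSystem V) {p q : V × V}
    (hp : M.graph.Adj p.1 p.2) (hq : q ∈ M.faceOf p) : M.graph.Adj q.1 q.2 :=
  M.faceOf_subset_of_mapsTo (S := {x | M.graph.Adj x.1 x.2})
    (fun _ h => M.adj_facePerm_iff.2 h) hp hq

theorem faceOf_mem_faces (M : RotationSystem V) {p : V × V} (hp : M.graph.Adj p.1 p.2) :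
    M.faceOf p ∈ M.faces := ⟨p, hp, rfl⟩

theorem eq_faceOf_of_mem (M : RotationSystem V) {S : Set (V × V)} (hS : S ∈ M.faces) {p : V × V}
    (hp : p ∈ S) : S = M.faceOf p := by
  obtain ⟨q, -, rfl⟩ := hS
  exact (M.faceOf_eq_of_mem hp).symm

theorem adj_of_mem_face [Finite V] (M : RotationSystem V) {S : Set (V × V)} (hS : S ∈ M.faces)
    {p : V × V} (hp : p ∈ S) : M.graph.Adj p.1 p.2 := by
  obtain ⟨q, hq, rfl⟩ := hS
  exact M.adj_of_mem_faceOf hq hp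

theorem nonempty_of_mem_faces (M : RotationSystem V) {S : Set (V × V)} (hS : S ∈ M.faces) :
    S.Nonempty := by
  obtain ⟨q, -, rfl⟩ := hS
  exact ⟨q, M.mem_faceOf_self q⟩

theorem facePerm_mem_face (M : RotationSystem V) {S : Set (V × V)} (hS : S ∈ M.faces) {p : V × V}
    (hp : p ∈ S) : M.facePerm p ∈ S := by
  obtain ⟨q, -, rfl⟩ := hS
  exact M.facePerm_mem_faceOf_iff.2 hp

/-- The neighbours of `v` form one finite cycle, so turning in one direction reaches all of them. -/
theorem rot_induction [Finite V] (M : RotationSystem V) (v : V) {Q : V → Prop} {w : V}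
    (hw : M.graph.Adj v w) (h0 : Q w)
    (hs : ∀ x, M.graph.Adj v x → Q x → Q (M.rot v x)) {y : V} (hy : M.graph.Adj v y) : Q y := by
  obtain ⟨n, -, rfl⟩ :=
    Equiv.Perm.SameCycle.exists_pow_eq' ((M.rot_isCycleOn v).2 (show w ∈ _ from hw) hy)
  clear hy
  have key : M.graph.Adj v ((M.rot v ^ n) w) ∧ Q ((M.rot v ^ n) w) := by
    induction n with
    | zero => simpa using ⟨hw, h0⟩
    | succ n ih =>
      rw [pow_succ', Equiv.Perm.mul_apply]
      exact ⟨M.adj_rot_iff.2 ih.1, hs _ ih.1 ih.2⟩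
  exact key.2

theorem isCycleOn_faceOf (M : RotationSystem V) (p : V × V) :
    M.facePerm.IsCycleOn (M.faceOf p) := by
  refine ⟨⟨fun x hx => M.facePerm_mem_faceOf_iff.2 hx, M.facePerm.injective.injOn, ?_⟩, ?_⟩
  · intro x hx
    refine ⟨M.facePerm.symm x, ?_, by simp⟩
    rw [← M.facePerm_mem_faceOf_iff]
    simpa using hx
  · intro x hx y hy
    exact (Equiv.Perm.SameCycle.symm hx).trans hy

end RotationSystem

/-! ### Homology of the sphere modulo 2 -/

namespace RotationSystem

variable {V : Type*}

section Homology

open Classical in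
/-- The value at a dart of a function on the faces. -/
noncomputable def faceVal (M : RotationSystem V) (h : M.faces → ZMod 2) (p : V × V) : ZMod 2 :=
  if hp : M.graph.Adj p.1 p.2 then h ⟨M.faceOf p, M.faceOf_mem_faces hp⟩ else 0

theorem faceVal_of_adj (M : RotationSystem V) (h : M.faces → ZMod 2) {p : V × V}
    (hp : M.graph.Adj p.1 p.2) :
    M.faceVal h p = h ⟨M.faceOf p, M.faceOf_mem_faces hp⟩ := dif_pos hp

theorem faceVal_facePerm (M : RotationSystem V) (h : M.faces → ZMod 2) (p : V × V) :
    M.faceVal h (M.facePerm p) = M.faceVal h p := by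
  unfold faceVal
  by_cases hp : M.graph.Adj p.1 p.2
  · rw [dif_pos hp, dif_pos (M.adj_facePerm_iff.2 hp)]
    simp only [M.faceOf_facePerm]
  · rw [dif_neg hp, dif_neg (fun h => hp (M.adj_facePerm_iff.1 h))]

/-- The boundary modulo 2 of a set of faces. -/
noncomputable def faceBoundary (M : RotationSystem V) :
    (M.faces → ZMod 2) →ₗ[ZMod 2] (M.graph.edgeSet → ZMod 2) where
  toFun h e := M.faceVal h (Quot.out e.1) + M.faceVal h (Quot.out e.1).swap
  map_add' h k := by
    ext e
    simp only [faceVal, Pi.add_apply]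
    split_ifs <;> ring
  map_smul' c h := by
    ext e
    simp only [faceVal, Pi.smul_apply, smul_eq_mul, RingHom.id_apply]
    split_ifs <;> ring

/-- The sum is symmetric in the two darts, so the representative chosen by `Quot.out` does not
matter. -/
theorem faceBoundary_apply (M : RotationSystem V) (h : M.faces → ZMod 2) {a b : V}
    (hab : M.graph.Adj a b) :
    M.faceBoundary h ⟨s(a, b), hab⟩ = M.faceVal h (a, b) + M.faceVal h (b, a) := by
  have : s((Quot.out s(a, b)).1, (Quot.out s(a, b)).2) = s(a, b) := Quot.out_eq s(a, b)
  change M.faceVal h (Quot.out s(a, b)) + M.faceVal h (Quot.out s(a, b)).swap = _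
  generalize Quot.out s(a, b) = o at this
  obtain ⟨x, y⟩ := o
  rw [Sym2.eq_iff] at this
  obtain ⟨h1, h2⟩ | ⟨h1, h2⟩ := this
  · simp only at h1 h2; subst h1 h2; rfl
  · simp only at h1 h2; subst h1 h2; exact add_comm _ _

open Classical in
/-- The boundary modulo 2 of a set of edges. -/
noncomputable def edgeBoundary [Fintype V] (M : RotationSystem V) :
    (M.graph.edgeSet → ZMod 2) →ₗ[ZMod 2] (V → ZMod 2) where
  toFun φ v := ∑ e : M.graph.edgeSet, if v ∈ e.1 then φ e else 0
  map_add' φ ψ := by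
    ext v
    simp only [Pi.add_apply, ← Finset.sum_add_distrib]
    refine Finset.sum_congr rfl fun e _ => ?_
    split_ifs <;> simp
  map_smul' c φ := by
    ext v
    simp only [Pi.smul_apply, smul_eq_mul, RingHom.id_apply, Finset.mul_sum]
    refine Finset.sum_congr rfl fun e _ => ?_
    split_ifs <;> simp

open Classical in
theorem edgeBoundary_apply [Fintype V] (M : RotationSystem V) (φ : M.graph.edgeSet → ZMod 2)
    (v : V) : M.edgeBoundary φ v = ∑ e : M.graph.edgeSet, if v ∈ e.1 then φ e else 0 := rfl

open Classical in
theorem edgeBoundary_single [Fintype V] (M : RotationSystem V) {a b : V}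
    (hab : M.graph.Adj a b) :
    M.edgeBoundary (Pi.single ⟨s(a, b), hab⟩ 1) = Pi.single a 1 + Pi.single b 1 := by
  ext v
  rw [edgeBoundary_apply, Finset.sum_eq_single ⟨s(a, b), hab⟩]
  · have hne := hab.ne
    by_cases h1 : v = a
    · subst h1; simp [hne]
    · by_cases h2 : v = b
      · subst h2; simp [hne.symm]
      · simp [h1, h2]
  · intro e _ he
    simp [he]
  · simp

theorem two_eq_zero_zmod (x : ZMod 2) : x + x = 0 := CharTwo.add_self_eq_zero x

-- The composition of the boundary maps vanishes: `facePerm` matches each dart into `v` with a dart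
-- out of `v` on the same face, so every angle at `v` contributes twice.
open Classical in
theorem edgeBoundary_faceBoundary [Fintype V] (M : RotationSystem V) (h : M.faces → ZMod 2) :
    M.edgeBoundary (M.faceBoundary h) = 0 := by
  ext v
  rw [edgeBoundary_apply]
  have e1 : (∑ e : M.graph.edgeSet, if v ∈ e.1 then M.faceBoundary h e else 0)
      = ∑ w : V with M.graph.Adj v w, (M.faceVal h (v, w) + M.faceVal h (w, v)) := by
    rw [← Finset.sum_filter]
    symm
    refine Finset.sum_bij (fun w hw => ⟨s(v, w), by simpa using hw⟩) ?_ ?_ ?_ ?_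
    · intro w hw
      simp
    · intro w _ w' _ hww
      exact Sym2.congr_right.1 (Subtype.ext_iff.1 hww)
    · rintro ⟨e, he⟩ hv
      simp only [Finset.mem_filter, Finset.mem_univ, true_and] at hv
      obtain ⟨w, rfl⟩ := Sym2.mem_iff_exists.1 hv
      exact ⟨w, by simpa using he, rfl⟩
    · intro w hw
      exact (M.faceBoundary_apply h _).symm
  rw [e1, Finset.sum_add_distrib]
  have e2 : ∑ w : V with M.graph.Adj v w, M.faceVal h (w, v)
      = ∑ w : V with M.graph.Adj v w, M.faceVal h (v, w) := by
    refine Finset.sum_equiv (M.rot v) ?_ ?_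
    · intro w
      simp [M.adj_rot_iff]
    · intro w _
      rw [← M.faceVal_facePerm h (w, v)]
      rfl
  rw [e2]
  exact two_eq_zero_zmod _

open Classical in
theorem sum_edgeBoundary [Fintype V] (M : RotationSystem V) (φ : M.graph.edgeSet → ZMod 2) :
    ∑ v, M.edgeBoundary φ v = 0 := by
  have : φ = ∑ e, φ e • Pi.single e (1 : ZMod 2) := by
    ext e; simp [Finset.sum_apply, Pi.single_apply]
  rw [this, map_sum]
  simp only [Finset.sum_apply]
  rw [Finset.sum_comm]
  refine Finset.sum_eq_zero fun e _ => ?_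
  obtain ⟨e, he⟩ := e
  induction e using Sym2.ind with
  | _ a b =>
    rw [map_smul, edgeBoundary_single M he]
    simp [Finset.sum_add_distrib, ← Finset.mul_sum, two_eq_zero_zmod]

/-- Zero boundary means no change across an edge, hence none around a vertex, hence none at all in a
connected graph. -/
theorem faceVal_const_of_ker [Finite V] (M : RotationSystem V) (hc : M.graph.Connected)
    {h : M.faces → ZMod 2} (hh : M.faceBoundary h = 0) {p q : V × V}
    (hp : M.graph.Adj p.1 p.2) (hq : M.graph.Adj q.1 q.2) :
    M.faceVal h q = M.faceVal h p := by
  have hsw : ∀ a b, M.graph.Adj a b → M.faceVal h (a, b) = M.faceVal h (b, a) := by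
    intro a b hab
    have := congrFun hh ⟨s(a, b), hab⟩
    rw [faceBoundary_apply] at this
    exact CharTwo.add_eq_zero.1 this
  have hv : ∀ v w, M.graph.Adj v w → ∀ y, M.graph.Adj v y →
      M.faceVal h (v, y) = M.faceVal h (v, w) := by
    intro v w hw y hy
    refine M.rot_induction v (Q := fun y => M.faceVal h (v, y) = M.faceVal h (v, w)) hw rfl
      ?_ hy
    intro x hx ih
    rw [← ih, hsw v x hx, ← M.faceVal_facePerm h (x, v)]
    rfl
  have hr := (SimpleGraph.reachable_iff_reflTransGen _ _).1 (hc.preconnected p.1 q.1)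
  have key : ∀ v, Relation.ReflTransGen M.graph.Adj p.1 v →
      ∀ w, M.graph.Adj v w → M.faceVal h (v, w) = M.faceVal h p := by
    intro v hv'
    induction hv' with
    | refl => exact fun w hw => hv p.1 p.2 hp w hw
    | tail _ hbc ih =>
      intro w hw
      rw [hv _ _ hbc.symm w hw, ← hsw _ _ hbc]
      exact ih _ hbc
  exact key _ hr _ hq

-- Modulo boundaries all vertices of a connected graph coincide, so the range and one vertex `r`
-- span the whole space.
open Classical in
theorem finrank_range_edgeBoundary [Fintype V] (M : RotationSystem V)
    (hc : M.graph.Connected) :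
    Fintype.card V ≤ Module.finrank (ZMod 2) (LinearMap.range M.edgeBoundary) + 1 := by
  obtain ⟨r⟩ := hc.nonempty
  set R := LinearMap.range M.edgeBoundary
  set L := Submodule.span (ZMod 2) {(Pi.single r 1 : V → ZMod 2)}
  have hmem : ∀ v, (Pi.single v 1 : V → ZMod 2) ∈ R ⊔ L := by
    intro v
    have hr := (SimpleGraph.reachable_iff_reflTransGen _ _).1 (hc.preconnected r v)
    induction hr with
    | refl => exact Submodule.mem_sup_right (Submodule.mem_span_singleton_self _)
    | tail _ hbc ih =>
      rename_i b c _
      have h1 : (Pi.single b 1 + Pi.single c 1 : V → ZMod 2) ∈ R ⊔ L :=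
        Submodule.mem_sup_left ⟨_, M.edgeBoundary_single hbc⟩
      have := Submodule.sub_mem _ h1 ih
      simpa using this
  have htop : R ⊔ L = ⊤ := by
    rw [eq_top_iff]
    intro x _
    have : x = ∑ v, x v • (Pi.single v 1 : V → ZMod 2) := by
      ext e; simp [Finset.sum_apply, Pi.single_apply]
    rw [this]
    exact Submodule.sum_mem _ fun v _ => Submodule.smul_mem _ _ (hmem v)
  have h1 := Submodule.finrank_add_le_finrank_add_finrank R L
  rw [htop, finrank_top, Module.finrank_fintype_fun_eq_card] at h1
  have h2 : Module.finrank (ZMod 2) L ≤ 1 := (finrank_span_le_card _).trans (by simp)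
  omega

open Classical in
/-- On the sphere, every cycle modulo 2 bounds a set of faces. -/
theorem exists_faceBoundary_eq [Fintype V] (M : RotationSystem V) (hM : M.IsPlanar)
    {φ : M.graph.edgeSet → ZMod 2} (hφ : M.edgeBoundary φ = 0) :
    ∃ h, M.faceBoundary h = φ := by
  obtain ⟨hc, heuler⟩ := hM
  have hle : LinearMap.range M.faceBoundary ≤ LinearMap.ker M.edgeBoundary := by
    rintro _ ⟨h, rfl⟩
    exact M.edgeBoundary_faceBoundary h
  have hker : Module.finrank (ZMod 2) (LinearMap.ker M.faceBoundary) ≤ 1 := by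
    have : LinearMap.ker M.faceBoundary
        ≤ Submodule.span (ZMod 2) {(fun _ => 1 : M.faces → ZMod 2)} := by
      intro h hh
      rw [Submodule.mem_span_singleton]
      by_cases hne : Nonempty M.faces
      · obtain ⟨_, p, hp, rfl⟩ := hne
        refine ⟨M.faceVal h p, ?_⟩
        ext ⟨_, q, hq, rfl⟩
        have := M.faceVal_const_of_ker hc hh hp hq
        rw [faceVal_of_adj M h hq] at this
        simp [this]
      · exact ⟨0, by ext S; exact (hne ⟨S⟩).elim⟩
    exact (Submodule.finrank_mono this).trans ((finrank_span_le_card _).trans (by simp))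
  have r1 := LinearMap.finrank_range_add_finrank_ker M.faceBoundary
  have r2 := LinearMap.finrank_range_add_finrank_ker M.edgeBoundary
  rw [Module.finrank_fintype_fun_eq_card] at r1 r2
  have h3 := M.finrank_range_edgeBoundary hc
  rw [Nat.card_eq_fintype_card, ← Nat.card_coe_set_eq, ← Nat.card_coe_set_eq,
    Nat.card_eq_fintype_card, Nat.card_eq_fintype_card] at heuler
  -- The range has dimension at least F - 1, the kernel at most E - V + 1, and these numbers agree
  -- by Euler's formula.
  have := Submodule.eq_of_le_of_finrank_le hle (by omega)
  have hm : φ ∈ LinearMap.range M.faceBoundary := by rw [this]; exact hφ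
  exact hm

end Homology

end RotationSystem

/-! ### Regions bounded by a triangle -/

namespace RotationSystem

variable {V : Type*}

/-- The three edges of a triangle. -/
def triangleEdges (u w v : V) : Set (Sym2 V) := {s(u, w), s(w, v), s(v, u)}

/-- A union of faces whose boundary consists of the edges in `γ`. -/
structure IsRegion (M : RotationSystem V) (S : Set (V × V)) (γ : Set (Sym2 V)) : Prop where
  adj : ∀ p ∈ S, M.graph.Adj p.1 p.2
  facePerm_mem_iff : ∀ p, M.facePerm p ∈ S ↔ p ∈ S
  swap_mem_iff : ∀ p : V × V, M.graph.Adj p.1 p.2 → s(p.1, p.2) ∉ γ → (p.swap ∈ S ↔ p ∈ S)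
  swap_mem_iff_notMem : ∀ p : V × V, M.graph.Adj p.1 p.2 → s(p.1, p.2) ∈ γ →
    (p.swap ∈ S ↔ p ∉ S)

theorem zmod_two_add_eq_one {a b : ZMod 2} (h : a + b = 1) : (b = 1 ↔ ¬ a = 1) := by
  revert a b; decide

theorem zmod_two_add_eq_zero {a b : ZMod 2} (h : a + b = 0) : (b = 1 ↔ a = 1) := by
  revert a b; decide

open Classical in
/-- The Jordan curve theorem for a triangle. -/
theorem exists_isRegion [Fintype V] (M : RotationSystem V) (hM : M.IsPlanar) {u w v : V}
    (huw : M.graph.Adj u w) (hwv : M.graph.Adj w v) (hvu : M.graph.Adj v u)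
    {F : Set (V × V)} (hF : F ∈ M.faces) :
    ∃ S, M.IsRegion S (triangleEdges u w v) ∧ ∀ p ∈ F, p ∉ S := by
  set φ : M.graph.edgeSet → ZMod 2 := fun e => if e.1 ∈ triangleEdges u w v then 1 else 0
    with hφdef
  have n1 := huw.ne
  have n2 := hwv.ne
  have n3 := hvu.ne
  have hφ : φ = Pi.single ⟨s(u, w), huw⟩ 1 + Pi.single ⟨s(w, v), hwv⟩ 1
      + Pi.single ⟨s(v, u), hvu⟩ 1 := by
    ext ⟨e, he⟩
    simp only [hφdef, triangleEdges, Set.mem_insert_iff, Set.mem_singleton_iff, Pi.add_apply,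
      Pi.single_apply, Subtype.ext_iff]
    by_cases h1 : e = s(u, w)
    · subst h1
      have : s(u, w) ≠ s(w, v) := by simp; grind
      have : s(u, w) ≠ s(v, u) := by simp; grind
      simp [*]
    · by_cases h2 : e = s(w, v)
      · subst h2
        have : s(w, v) ≠ s(v, u) := by simp; grind
        simp [*]
      · simp [*]
  have hb : M.edgeBoundary φ = 0 := by
    rw [hφ, map_add, map_add, edgeBoundary_single, edgeBoundary_single, edgeBoundary_single]
    ext x
    simp only [Pi.add_apply, Pi.zero_apply]
    generalize (Pi.single u 1 : V → ZMod 2) x = a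
    generalize (Pi.single w 1 : V → ZMod 2) x = b
    generalize (Pi.single v 1 : V → ZMod 2) x = c
    revert a b c; decide
  obtain ⟨h, hh⟩ := M.exists_faceBoundary_eq hM hb
  -- Adding the constant `c` to `h` leaves its boundary unchanged and gives `F` the value 0.
  set c := h ⟨F, hF⟩ with hc
  refine ⟨{p | M.graph.Adj p.1 p.2 ∧ M.faceVal h p + c = 1}, ⟨?_, ?_, ?_, ?_⟩, ?_⟩
  · exact fun p hp => hp.1
  · intro p
    simp only [Set.mem_ofPred_eq, M.adj_facePerm_iff, M.faceVal_facePerm]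
  · rintro ⟨a, b⟩ hab hγ
    have h1 := congrFun hh ⟨s(a, b), hab⟩
    rw [faceBoundary_apply, hφdef] at h1
    simp only [if_neg hγ] at h1
    have hab' : M.graph.Adj a b := hab
    simp only [Set.mem_ofPred_eq, Prod.swap, hab', hab'.symm, true_and]
    refine zmod_two_add_eq_zero ?_
    rw [← h1]
    generalize M.faceVal h (a, b) = x
    generalize M.faceVal h (b, a) = y
    generalize c = z
    revert x y z; decide
  · rintro ⟨a, b⟩ hab hγ
    have h1 := congrFun hh ⟨s(a, b), hab⟩
    rw [faceBoundary_apply, hφdef] at h1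
    simp only [if_pos hγ] at h1
    have hab' : M.graph.Adj a b := hab
    simp only [Set.mem_ofPred_eq, Prod.swap, hab', hab'.symm, true_and]
    refine zmod_two_add_eq_one ?_
    rw [← h1]
    generalize M.faceVal h (a, b) = x
    generalize M.faceVal h (b, a) = y
    generalize c = z
    revert x y z; decide
  · rintro p hp ⟨hadj, h1⟩
    rw [faceVal_of_adj M h hadj] at h1
    have : h ⟨M.faceOf p, M.faceOf_mem_faces hadj⟩ = c := by
      rw [hc]; congr 2; exact (M.eq_faceOf_of_mem hF hp).symm
    rw [this, two_eq_zero_zmod] at h1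
    exact zero_ne_one h1

namespace IsRegion

variable {M : RotationSystem V} {S : Set (V × V)} {γ : Set (Sym2 V)}

theorem faceOf_subset [Finite V] (hS : M.IsRegion S γ) {p : V × V} (hp : p ∈ S) :
    M.faceOf p ⊆ S :=
  M.faceOf_subset_of_mapsTo (fun q hq => (hS.facePerm_mem_iff q).2 hq) hp

/-- The next angle at a vertex is on the same side, unless a boundary edge is crossed. -/
theorem next_angle_mem_iff (hS : M.IsRegion S γ) {x w : V} (h : M.graph.Adj w x)
    (hγ : s(w, M.rot w x) ∉ γ) : (M.rot w x, w) ∈ S ↔ (x, w) ∈ S := by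
  rw [← hS.facePerm_mem_iff (x, w)]
  exact hS.swap_mem_iff (w, M.rot w x) (M.adj_rot_iff.2 h) hγ

theorem next_angle_mem_iff_notMem (hS : M.IsRegion S γ) {x w : V} (h : M.graph.Adj w x)
    (hγ : s(w, M.rot w x) ∈ γ) : (M.rot w x, w) ∈ S ↔ (x, w) ∉ S := by
  rw [← hS.facePerm_mem_iff (x, w)]
  exact hS.swap_mem_iff_notMem (w, M.rot w x) (M.adj_rot_iff.2 h) hγ

/-- The angles at a vertex off the boundary are on the same side. -/
theorem angle_mem_of_interior [Finite V] (hS : M.IsRegion S γ) {x y w : V}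
    (hw : ∀ e ∈ γ, w ∉ e) (hx : (x, w) ∈ S) (hy : M.graph.Adj w y) : (y, w) ∈ S := by
  refine M.rot_induction w (Q := fun y => (y, w) ∈ S) (hS.adj _ hx).symm hx ?_ hy
  intro z hz ih
  exact (hS.next_angle_mem_iff hz fun h => hw _ h (Sym2.mem_mk_left _ _)).2 ih

/-- If two consecutive edges of a face belong to the boundary triangle, then the angle between
them is on one side, and all other angles at this vertex are on the other side. -/
theorem angle_mem_iff_of_corner [Finite V] {u w v : V}
    (hS : M.IsRegion S (triangleEdges u w v)) (huw : M.graph.Adj u w)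
    (hr : M.rot w u = v) (hvu : M.graph.Adj v u) {x : V}
    (hx : M.graph.Adj w x) (hxu : x ≠ u) : (x, w) ∈ S ↔ (u, w) ∉ S := by
  have hwv : M.graph.Adj w v := hr ▸ M.adj_rot_iff.2 huw.symm
  have h0 : (v, w) ∈ S ↔ (u, w) ∉ S := by
    have := hS.next_angle_mem_iff_notMem huw.symm (by simp [hr, triangleEdges])
    rwa [hr] at this
  -- Starting at `v`, the side changes only at the step into `u` and again at the step from `u` to
  -- `v`; the invariant therefore exempts `u`.
  refine (M.rot_induction w (Q := fun y => y = u ∨ ((y, w) ∈ S ↔ (u, w) ∉ S)) hwv (Or.inr h0)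
    ?_ hx).resolve_left hxu
  intro z hz ih
  by_cases hzu : z = u
  · subst hzu; rw [hr]; exact Or.inr h0
  by_cases hzu' : M.rot w z = u
  · exact Or.inl hzu'
  right
  rw [hS.next_angle_mem_iff hz, ih.resolve_left hzu]
  have : M.rot w z ≠ v := fun h => hzu ((M.rot w).injective (h.trans hr.symm))
  have := huw.ne
  have := hwv.ne
  simp [triangleEdges]
  grind

end IsRegion

/-- The edges in the interior of a region. -/
def innerEdges (M : RotationSystem V) (S : Set (V × V)) (γ : Set (Sym2 V)) : Set (Sym2 V) :=
  {e | e ∈ M.graph.edgeSet ∧ e ∉ γ ∧ ∃ p ∈ S, s(p.1, p.2) = e}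

/-- The vertices of a region that do not belong to the edges in `γ`. -/
def innerVerts (S : Set (V × V)) (γ : Set (Sym2 V)) : Set V :=
  {x | (∀ e ∈ γ, x ∉ e) ∧ ∃ p ∈ S, p.2 = x}

def innerFaces (M : RotationSystem V) (S : Set (V × V)) : Set (Set (V × V)) :=
  {F | F ∈ M.faces ∧ F ⊆ S}

-- The first homology of a disc relative to its boundary vanishes. Here `L` is the boundary from
-- inner edges to inner vertices and `Ψ` the one from inner faces to inner edges. Since `ker L ≤
-- range Ψ` and the constant 1 lies in `ker Ψ`, the number of inner edges is at most the number of
-- inner vertices plus that of inner faces minus 1.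
open Classical in
theorem IsRegion.euler_le [Fintype V] {M : RotationSystem V} (hM : M.IsPlanar) {u w v : V}
    (huw : M.graph.Adj u w) (hwv : M.graph.Adj w v) (hvu : M.graph.Adj v u)
    {S : Set (V × V)} (hS : M.IsRegion S (triangleEdges u w v)) (hne : S.Nonempty) :
    (M.innerEdges S (triangleEdges u w v)).ncard + 1
      ≤ (innerVerts S (triangleEdges u w v)).ncard + (M.innerFaces S).ncard := by
  set γ := triangleEdges u w v with hγ
  set EI := M.innerEdges S γ
  set VI := innerVerts S γ
  set FI := M.innerFaces S
  set iE : EI → M.graph.edgeSet := fun e => ⟨e.1, e.2.1⟩ with hiE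
  set iF : FI → M.faces := fun f => ⟨f.1, f.2.1⟩ with hiF
  have iEinj : Function.Injective iE := fun a b h => Subtype.ext (congrArg (·.1) h)
  have iFinj : Function.Injective iF := fun a b h => Subtype.ext (congrArg (·.1) h)
  set L : (EI → ZMod 2) →ₗ[ZMod 2] (VI → ZMod 2) :=
    (LinearMap.funLeft (ZMod 2) (ZMod 2) (Subtype.val : VI → V)).comp
      (M.edgeBoundary.comp (Function.ExtendByZero.linearMap (ZMod 2) iE)) with hL
  set Ψ : (FI → ZMod 2) →ₗ[ZMod 2] (EI → ZMod 2) :=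
    (LinearMap.funLeft (ZMod 2) (ZMod 2) iE).comp
      (M.faceBoundary.comp (Function.ExtendByZero.linearMap (ZMod 2) iF)) with hΨ
  have hsub : ∀ p ∈ S, M.faceOf p ∈ FI := fun p hp =>
    ⟨M.faceOf_mem_faces (hS.adj p hp), hS.faceOf_subset hp⟩
  have hval : ∀ (k : FI → ZMod 2) p (hp : p ∈ S),
      M.faceVal (Function.extend iF k 0) p = k ⟨M.faceOf p, hsub p hp⟩ := by
    intro k p hp
    rw [faceVal_of_adj _ _ (hS.adj p hp)]
    exact iFinj.extend_apply k 0 ⟨M.faceOf p, hsub p hp⟩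
  have hΨval : ∀ (k : FI → ZMod 2) a b (hp : (a, b) ∈ S) (hp' : (b, a) ∈ S)
      (he : s(a, b) ∈ EI), Ψ k ⟨s(a, b), he⟩
        = k ⟨M.faceOf (a, b), hsub _ hp⟩ + k ⟨M.faceOf (b, a), hsub _ hp'⟩ := by
    intro k a b hp hp' he
    have : Ψ k ⟨s(a, b), he⟩ = M.faceBoundary (Function.extend iF k 0) ⟨s(a, b), he.1⟩ := rfl
    rw [this, ← hval k _ hp, ← hval k _ hp']
    exact M.faceBoundary_apply _ he.1
  have hEI : ∀ e ∈ EI, ∃ a b, e = s(a, b) ∧ (a, b) ∈ S ∧ (b, a) ∈ S := by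
    rintro e ⟨he, heγ, ⟨a, b⟩, hp, rfl⟩
    exact ⟨a, b, rfl, hp, (hS.swap_mem_iff (a, b) (hS.adj _ hp) heγ).2 hp⟩
  have hker : LinearMap.ker L ≤ LinearMap.range Ψ := by
    intro φ hφ
    set ψ := M.edgeBoundary (Function.extend iE φ 0) with hψ
    have hψ0 : ∀ x, x ≠ u → x ≠ w → x ≠ v → ψ x = 0 := by
      intro x hxu hxw hxv
      by_cases hx : x ∈ VI
      · exact congrFun (show L φ = 0 from hφ) ⟨x, hx⟩
      · rw [hψ, edgeBoundary_apply]
        refine Finset.sum_eq_zero fun e _ => ?_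
        split_ifs with hxe
        · refine Function.extend_apply' _ _ _ ?_
          rintro ⟨e', rfl⟩
          obtain ⟨a, b, hab, h1, h2⟩ := hEI e'.1 e'.2
          have hxe' : x ∈ e'.1 := hxe
          rw [hab, Sym2.mem_iff] at hxe'
          have hxγ : ∀ e ∈ γ, x ∉ e := by
            intro e he
            simp only [hγ, triangleEdges, Set.mem_insert_iff, Set.mem_singleton_iff] at he
            rcases he with rfl | rfl | rfl <;> simp [*]
          rcases hxe' with rfl | rfl
          · exact hx ⟨hxγ, _, h2, rfl⟩
          · exact hx ⟨hxγ, _, h1, rfl⟩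
        · rfl
    have n1 := huw.ne
    have n2 := hwv.ne
    have n3 := hvu.ne
    have hsum : ψ u + ψ w + ψ v = 0 := by
      have h0 := M.sum_edgeBoundary (Function.extend iE φ 0)
      rw [← Finset.sum_subset (Finset.subset_univ {u, w, v})] at h0
      · rw [Finset.sum_insert (by simp [n1, n3.symm]), Finset.sum_insert (by simp [n2]),
          Finset.sum_singleton, ← add_assoc] at h0
        exact h0
      · intro x _ hx
        simp only [Finset.mem_insert, Finset.mem_singleton, not_or] at hx
        exact hψ0 x hx.1 hx.2.1 hx.2.2
    -- The boundary `ψ` lives on the three corners and has sum 0, so two sides of the triangle with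
    -- weights `ψ u` and `ψ w` close `φ` up to a cycle without changing it on inner edges.
    set φ' : M.graph.edgeSet → ZMod 2 := Function.extend iE φ 0
      + (ψ u • Pi.single ⟨s(v, u), hvu⟩ 1 + ψ w • Pi.single ⟨s(w, v), hwv⟩ 1) with hφ'
    have hb : M.edgeBoundary φ' = 0 := by
      rw [hφ', map_add, map_add, map_smul, map_smul, edgeBoundary_single, edgeBoundary_single,
        ← hψ]
      ext x
      simp only [Pi.add_apply, Pi.smul_apply, Pi.zero_apply, Pi.single_apply, smul_eq_mul]
      by_cases h1 : x = u
      · subst h1; simp [n1, n3.symm, two_eq_zero_zmod]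
      by_cases h2 : x = w
      · subst h2; simp [n1.symm, n2, two_eq_zero_zmod]
      by_cases h3 : x = v
      · subst h3; simp [n2.symm, n3]; rw [← hsum]; ring
      simp [h1, h2, h3, hψ0 x h1 h2 h3]
    obtain ⟨h, hh⟩ := M.exists_faceBoundary_eq hM hb
    -- Both sides of an inner edge lie in `S`, so the values of `h` outside `S` are irrelevant
    -- there.
    refine ⟨fun f => h (iF f), ?_⟩
    ext ⟨e, he⟩
    obtain ⟨a, b, rfl, h1, h2⟩ := hEI e he
    rw [hΨval _ a b h1 h2]
    have h3 := (M.faceBoundary_apply h he.1).symm.trans (congrFun hh ⟨s(a, b), he.1⟩)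
    rw [faceVal_of_adj _ _ (hS.adj _ h1), faceVal_of_adj _ _ (hS.adj _ h2)]
      at h3
    refine h3.trans ?_
    have he' := he.2.1
    simp only [hγ, triangleEdges, Set.mem_insert_iff, Set.mem_singleton_iff, not_or] at he'
    have h4 : Function.extend iE φ 0 ⟨s(a, b), he.1⟩ = φ ⟨s(a, b), he⟩ :=
      iEinj.extend_apply φ 0 ⟨s(a, b), he⟩
    simp only [hφ', Pi.add_apply, Pi.smul_apply, Pi.single_apply, h4, Subtype.ext_iff,
      he'.2.1, he'.2.2, if_false, smul_zero, add_zero]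
  have hkerΨ : 1 ≤ Module.finrank (ZMod 2) (LinearMap.ker Ψ) := by
    rw [Nat.one_le_iff_ne_zero, ← Nat.pos_iff_ne_zero, Module.finrank_pos_iff_exists_ne_zero]
    obtain ⟨p, hp⟩ := hne
    refine ⟨⟨fun _ => 1, ?_⟩, ?_⟩
    · ext ⟨e, he⟩
      obtain ⟨a, b, rfl, h1, h2⟩ := hEI e he
      rw [hΨval _ a b h1 h2]
      exact two_eq_zero_zmod 1
    · intro h0
      have := congrFun (congrArg Subtype.val h0) ⟨M.faceOf p, hsub p hp⟩
      exact one_ne_zero this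
  have r1 := LinearMap.finrank_range_add_finrank_ker L
  have r2 := LinearMap.finrank_range_add_finrank_ker Ψ
  have r3 := Submodule.finrank_mono hker
  have r4 := Submodule.finrank_le (LinearMap.range L)
  rw [Module.finrank_fintype_fun_eq_card] at r1 r2 r4
  rw [← Nat.card_coe_set_eq, ← Nat.card_coe_set_eq, ← Nat.card_coe_set_eq,
    Nat.card_eq_fintype_card, Nat.card_eq_fintype_card, Nat.card_eq_fintype_card]
  omega

end RotationSystem

/-! ### Counting angles in a region -/

namespace RotationSystem

variable {V : Type*}

-- An inner edge has at most two darts in `S`; a side of the triangle has only one, as its reverse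
-- lies across the boundary.
open Classical in
theorem IsRegion.ncard_le [Fintype V] {M : RotationSystem V} {u w v : V} {S : Set (V × V)}
    (hS : M.IsRegion S (triangleEdges u w v)) :
    S.ncard ≤ 2 * (M.innerEdges S (triangleEdges u w v)).ncard + 3 := by
  set γ := triangleEdges u w v with hγ
  set m : V × V → Sym2 V := fun p => s(p.1, p.2) with hm
  have hsplit : S = {p ∈ S | m p ∉ γ} ∪ {p ∈ S | m p ∈ γ} := by
    ext p
    by_cases h : m p ∈ γ <;> simp [h]
  have h2 : {p ∈ S | m p ∈ γ}.ncard ≤ 3 := by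
    have hinj : Set.InjOn m {p ∈ S | m p ∈ γ} := by
      rintro ⟨a, b⟩ ⟨h1, h2⟩ ⟨c, d⟩ ⟨h3, -⟩ h
      simp only [hm, Sym2.eq_iff] at h
      rcases h with ⟨rfl, rfl⟩ | ⟨rfl, rfl⟩
      · rfl
      · exact absurd h1 ((hS.swap_mem_iff_notMem (a, b) (hS.adj _ h1) h2).1 h3)
    rw [← hinj.ncard_image]
    refine (Set.ncard_le_ncard (t := γ) ?_ (Set.toFinite _)).trans ?_
    · rintro _ ⟨p, hp, rfl⟩
      exact hp.2
    · have h1 := Set.ncard_insert_le s(u, w) {s(w, v), s(v, u)}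
      have h2 := Set.ncard_insert_le s(w, v) {s(v, u)}
      rw [Set.ncard_singleton] at h2
      rw [hγ, triangleEdges]
      omega
  have h1 : {p ∈ S | m p ∉ γ}.ncard ≤ 2 * (M.innerEdges S γ).ncard := by
    rw [Set.ncard_eq_toFinset_card', Set.ncard_eq_toFinset_card']
    refine (Finset.card_le_mul_card_image (f := m) _ 2 ?_).trans ?_
    · intro e _
      induction e using Sym2.ind with
      | _ a b =>
        refine (Finset.card_le_card (t := {(a, b), (b, a)}) ?_).trans Finset.card_le_two
        rintro ⟨c, d⟩ h
        simp only [Finset.mem_filter, hm, Sym2.eq_iff] at h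
        simpa using h.2
    · refine Nat.mul_le_mul_left 2 (Finset.card_le_card ?_)
      intro e he
      simp only [Finset.mem_image, Set.mem_toFinset] at he
      obtain ⟨p, ⟨hp, hpγ⟩, rfl⟩ := he
      rw [Set.mem_toFinset]
      exact ⟨hS.adj p hp, hpγ, p, hp, rfl⟩
  have h3 := Set.ncard_union_le {p ∈ S | m p ∉ γ} {p ∈ S | m p ∈ γ}
  rw [← hsplit] at h3
  omega

open Classical in
theorem IsRegion.ncard_inter_eq_sum [Fintype V] {M : RotationSystem V} {S : Set (V × V)}
    {γ : Set (Sym2 V)} (hS : M.IsRegion S γ) (X : Set (V × V)) :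
    (S ∩ X).ncard = ∑ F ∈ (M.innerFaces S).toFinset, (F ∩ X).ncard := by
  rw [Set.ncard_eq_toFinset_card', Finset.card_eq_sum_card_fiberwise (f := M.faceOf)
    (t := (M.innerFaces S).toFinset)]
  · refine Finset.sum_congr rfl fun F hF => ?_
    rw [Set.ncard_eq_toFinset_card']
    congr 1
    ext p
    simp only [Set.mem_toFinset] at hF
    simp only [Finset.mem_filter, Set.mem_toFinset, Set.mem_inter_iff]
    constructor
    · rintro ⟨⟨-, h2⟩, rfl⟩
      exact ⟨M.mem_faceOf_self p, h2⟩
    · rintro ⟨h1, h2⟩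
      exact ⟨⟨hF.2 h1, h2⟩, (M.eq_faceOf_of_mem hF.1 h1).symm⟩
  · intro p hp
    simp only [Finset.mem_coe, Set.mem_toFinset] at hp ⊢
    exact ⟨M.faceOf_mem_faces (hS.adj p hp.1), hS.faceOf_subset hp.1⟩

theorem triangleEdges_off {u w v x : V} (hxu : x ≠ u) (hxw : x ≠ w) (hxv : x ≠ v) :
    ∀ e ∈ triangleEdges u w v, x ∉ e := by
  intro e he
  simp only [triangleEdges, Set.mem_insert_iff, Set.mem_singleton_iff] at he
  rcases he with rfl | rfl | rfl <;> simp [*]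

open Classical in
/-- A region bounded by a triangle whose faces satisfy the bound `hX` has no angle of `X` at
its three corners. -/
theorem IsRegion.corner_notMem [Fintype V] {M : RotationSystem V} (hM : M.IsPlanar) {u w v : V}
    (huw : M.graph.Adj u w) (hwv : M.graph.Adj w v) (hvu : M.graph.Adj v u)
    {S : Set (V × V)} (hS : M.IsRegion S (triangleEdges u w v)) {X : Set (V × V)}
    (hX : ∀ F ∈ M.faces, F ⊆ S → 2 * (F ∩ X).ncard + 2 ≤ F.ncard)
    (hXadj : ∀ p ∈ X, M.graph.Adj p.1 p.2) (hXv : ∀ x, ∃ p ∈ X, p.2 = x)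
    {p : V × V} (hp : p ∈ X) (hc : p.2 = u ∨ p.2 = w ∨ p.2 = v) : p ∉ S := by
  intro hpS
  have h1 := hS.euler_le hM huw hwv hvu ⟨p, hpS⟩
  have h2 := hS.ncard_le
  have h3 := hS.ncard_inter_eq_sum X
  have h4 := hS.ncard_inter_eq_sum Set.univ
  simp only [Set.inter_univ] at h4
  -- With n, m, f inner vertices, edges and faces, this gives 2|S ∩ X| + 2f ≤ |S| ≤ 2m + 3 ≤ 2(n +
  -- f) + 1, hence |S ∩ X| ≤ n.
  have h5 : 2 * (S ∩ X).ncard + 2 * (M.innerFaces S).ncard ≤ S.ncard := by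
    rw [h3, h4, Finset.mul_sum, Set.ncard_eq_toFinset_card', mul_comm 2 (Finset.card _),
      ← smul_eq_mul (a := Finset.card _), ← Finset.sum_const, ← Finset.sum_add_distrib]
    refine Finset.sum_le_sum fun F hF => ?_
    rw [Set.mem_toFinset] at hF
    exact hX F hF.1 hF.2
  -- All angles at an inner vertex lie in `S`, among them one of `X`; the corner angle `p` would be
  -- one more.
  have h6 : (innerVerts S (triangleEdges u w v)).ncard + 1 ≤ (S ∩ X).ncard := by
    rw [← Set.ncard_insert_of_notMem (a := p.2)]
    · refine (Set.ncard_le_ncard (t := Prod.snd '' (S ∩ X)) ?_).trans (Set.ncard_image_le)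
      intro x hx
      rcases hx with rfl | ⟨hx, q, hq, rfl⟩
      · exact ⟨p, ⟨hpS, hp⟩, rfl⟩
      · obtain ⟨r, hr, hrq⟩ := hXv q.2
        refine ⟨r, ⟨?_, hr⟩, hrq⟩
        have := hS.angle_mem_of_interior (w := q.2) (x := q.1) (y := r.1) hx hq
          (hrq ▸ (hXadj r hr).symm)
        rwa [← hrq] at this
    · rintro ⟨h, -⟩
      rcases hc with hc | hc | hc
      · exact h s(u, w) (by simp [triangleEdges]) (by simp [hc])
      · exact h s(u, w) (by simp [triangleEdges]) (by simp [hc])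
      · exact h s(w, v) (by simp [triangleEdges]) (by simp [hc])
  omega

end RotationSystem

/-! ### Inserting a point into a cycle -/

/-- The permutation `f` with the fixed point `w` inserted into a cycle, just before `y`. -/
def permInsert {V : Type*} [DecidableEq V] (f : Equiv.Perm V) (w y : V) : Equiv.Perm V :=
  Equiv.swap w y * f

theorem permErase_permInsert {V : Type*} [DecidableEq V] {f : Equiv.Perm V} {w : V}
    (hf : f w = w) (y : V) : permErase (permInsert f w y) w = f := by
  have : permInsert f w y w = y := by simp [permInsert, hf]
  rw [permErase, this, permInsert, ← mul_assoc, Equiv.swap_mul_self, one_mul]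

theorem permInsert_permErase {V : Type*} [DecidableEq V] {f : Equiv.Perm V} {w z : V}
    (hz : f z = w) : permInsert (permErase f w) w (permErase f w z) = f := by
  rw [permErase_of_eq f hz, permErase, permInsert, ← mul_assoc, Equiv.swap_mul_self, one_mul]

/-- Only the step into `y` is detoured through `w`, so each step of `f` in `s` becomes one or two
steps of the new permutation. -/
theorem permInsert_isCycleOn {V : Type*} [DecidableEq V] {f : Equiv.Perm V} {s : Set V}
    (hf : f.IsCycleOn s) {w y : V} (hw : f w = w) (hws : w ∉ s) (hy : y ∈ s) :
    (permInsert f w y).IsCycleOn (insert w s) := by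
  have gw : permInsert f w y w = y := by simp [permInsert, hw]
  have gy : ∀ x, f x = y → permInsert f w y x = w := fun x hx => by simp [permInsert, hx]
  have gx : ∀ x, x ≠ w → f x ≠ y → permInsert f w y x = f x := by
    intro x hxw hx
    have : f x ≠ w := fun h => hxw (f.injective (h.trans hw.symm))
    simp [permInsert, Equiv.swap_apply_of_ne_of_ne this hx]
  have hne : ∀ x ∈ s, x ≠ w := fun x hx h => hws (h ▸ hx)
  have step : ∀ x ∈ s, (permInsert f w y).SameCycle x (f x) := by
    intro x hx
    by_cases h : f x = y
    · have h1 : (permInsert f w y).SameCycle x (permInsert f w y (permInsert f w y x)) :=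
        Equiv.Perm.sameCycle_apply_right.2 (Equiv.Perm.sameCycle_apply_right.2
          (Equiv.Perm.SameCycle.refl _ _))
      rw [gy x h, gw] at h1
      rwa [h]
    · rw [← gx x (hne x hx) h]
      exact Equiv.Perm.sameCycle_apply_right.2 (Equiv.Perm.SameCycle.refl _ _)
  have pow : ∀ n : ℕ, ∀ x ∈ s, (permInsert f w y).SameCycle x ((f ^ n) x) := by
    intro n
    induction n with
    | zero => exact fun x _ => Equiv.Perm.SameCycle.refl _ _
    | succ n ih =>
      intro x hx
      rw [pow_succ, Equiv.Perm.mul_apply]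
      exact (step x hx).trans (ih _ (hf.1.mapsTo hx))
  have hs : ∀ x ∈ s, ∀ x' ∈ s, (permInsert f w y).SameCycle x x' := by
    intro x hx x' hx'
    obtain ⟨i, hi⟩ := hf.2 hx hx'
    obtain ⟨n, rfl | rfl⟩ := i.eq_nat_or_neg
    · rw [zpow_natCast] at hi
      subst hi
      exact pow n x hx
    · rw [zpow_neg, zpow_natCast, Equiv.Perm.inv_eq_iff_eq] at hi
      subst hi
      exact (pow n x' hx').symm
  have hwy : (permInsert f w y).SameCycle w y := by
    have h1 : (permInsert f w y).SameCycle w (permInsert f w y w) :=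
      Equiv.Perm.sameCycle_apply_right.2 (Equiv.Perm.SameCycle.refl _ _)
    rwa [gw] at h1
  refine ⟨⟨?_, (permInsert f w y).injective.injOn, ?_⟩, ?_⟩
  · rintro x (rfl | hx)
    · rw [gw]; exact Or.inr hy
    · by_cases h : f x = y
      · rw [gy x h]; exact Or.inl rfl
      · rw [gx x (hne x hx) h]; exact Or.inr (hf.1.mapsTo hx)
  · rintro x (rfl | hx)
    · obtain ⟨x', hx', h⟩ := hf.1.surjOn hy
      exact ⟨x', Or.inr hx', gy x' h⟩
    · by_cases h : x = y
      · subst h; exact ⟨w, Or.inl rfl, gw⟩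
      · obtain ⟨x', hx', rfl⟩ := hf.1.surjOn hx
        exact ⟨x', Or.inr hx', gx x' (hne x' hx') h⟩
  · rintro x (rfl | hx) x' (rfl | hx')
    · exact Equiv.Perm.SameCycle.refl _ _
    · exact hwy.trans (hs y hy x' hx')
    · exact (hs x hx y hy).trans hwy.symm
    · exact hs x hx x' hx'

/-! ### Triangular faces and removal of an edge -/

namespace RotationSystem

variable {V : Type*}

/-- The face to the left of the dart `(u, v)` is the triangle with the corners `u`, `v`, `z`. -/
structure IsTriangle (M : RotationSystem V) (u v z : V) : Prop where
  adj : M.graph.Adj u v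
  rot_v : M.rot v u = z
  rot_z : M.rot z v = u
  rot_u : M.rot u z = v

section

variable {M : RotationSystem V} {u v z : V}

namespace IsTriangle

theorem facePerm_uv (h : M.IsTriangle u v z) : M.facePerm (u, v) = (v, z) := by
  rw [facePerm_apply, h.rot_v]

theorem facePerm_vz (h : M.IsTriangle u v z) : M.facePerm (v, z) = (z, u) := by
  rw [facePerm_apply, h.rot_z]

theorem facePerm_zu (h : M.IsTriangle u v z) : M.facePerm (z, u) = (u, v) := by
  rw [facePerm_apply, h.rot_u]

theorem adj_vz (h : M.IsTriangle u v z) : M.graph.Adj v z := by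
  have := M.adj_rot_iff.2 h.adj.symm
  rwa [h.rot_v] at this

theorem adj_zu (h : M.IsTriangle u v z) : M.graph.Adj z u := by
  have := M.adj_rot_iff.2 h.adj_vz.symm
  rwa [h.rot_z] at this

theorem faceOf_uv [Finite V] (h : M.IsTriangle u v z) :
    M.faceOf (u, v) = {(u, v), (v, z), (z, u)} := by
  refine Set.Subset.antisymm (M.faceOf_subset_of_mapsTo ?_ (Or.inl rfl)) ?_
  · rintro p (rfl | rfl | rfl)
    · rw [h.facePerm_uv]; simp
    · rw [h.facePerm_vz]; simp
    · rw [h.facePerm_zu]; simp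
  · have h1 := M.mem_faceOf_self (u, v)
    have h2 := M.facePerm_mem_faceOf_iff.2 h1
    have h3 := M.facePerm_mem_faceOf_iff.2 h2
    rw [h.facePerm_uv] at h2 h3
    rw [h.facePerm_vz] at h3
    rintro p (rfl | rfl | rfl)
    exacts [h1, h2, h3]

theorem ncard_faceOf_uv [Finite V] (h : M.IsTriangle u v z) : (M.faceOf (u, v)).ncard = 3 := by
  have n1 := h.adj.ne
  have n2 := h.adj_vz.ne
  have n3 := h.adj_zu.ne
  rw [h.faceOf_uv, Set.ncard_insert_of_notMem, Set.ncard_pair]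
  · simp [n2]
  · simp [n1, n3.symm]

theorem vu_notMem [Finite V] (h : M.IsTriangle u v z) : (v, u) ∉ M.faceOf (u, v) := by
  rw [h.faceOf_uv]
  have n1 := h.adj.ne
  have n2 := h.adj_vz.ne
  have n3 := h.adj_zu.ne
  simp [n1, n1.symm, n2, n3.symm]

theorem uv_notMem [Finite V] (h : M.IsTriangle u v z) : (u, v) ∉ M.faceOf (v, u) :=
  fun hm => h.vu_notMem (Equiv.Perm.SameCycle.symm hm)

/-- The three corners of a triangular face. -/
theorem of_ncard [Finite V] (hd : M.graph.Adj u v) (h3 : (M.faceOf (u, v)).ncard = 3) :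
    ∃ z, M.IsTriangle u v z := by
  have hfin := Set.toFinite (M.faceOf (u, v))
  have hc : M.facePerm.IsCycleOn (hfin.toFinset : Set (V × V)) := by
    rw [hfin.coe_toFinset]; exact M.isCycleOn_faceOf _
  -- The third power of `facePerm` fixes `(u, v)`; the two coordinates of this equation are the
  -- rotations at `z` and at `u`.
  have := hc.pow_card_apply (a := (u, v)) (by simpa using M.mem_faceOf_self _)
  rw [← Set.ncard_eq_toFinset_card _ hfin, h3] at this
  simp only [pow_succ, pow_zero, one_mul, Equiv.Perm.mul_apply, facePerm_apply,
    Prod.mk.injEq] at this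
  exact ⟨M.rot v u, hd, rfl, this.1, by rw [← this.1]; simpa [this.1] using this.2⟩

end IsTriangle

end

section

variable [DecidableEq V] {M : RotationSystem V} {u v z : V}

theorem deleteEdge_adj (M : RotationSystem V) (p : V × V) {x y : V} :
    (M.deleteEdge p).graph.Adj x y ↔ M.graph.Adj x y ∧ s(x, y) ≠ s(p.1, p.2) := by
  simp [deleteEdge]

theorem deleteEdge_rot_fst (M : RotationSystem V) (u v : V) :
    (M.deleteEdge (u, v)).rot u = permErase (M.rot u) v := by
  simp [deleteEdge]

theorem deleteEdge_rot_snd (M : RotationSystem V) {u v : V} (h : u ≠ v) :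
    (M.deleteEdge (u, v)).rot v = permErase (M.rot v) u := by
  simp [deleteEdge, h.symm]

theorem deleteEdge_rot_of_ne (M : RotationSystem V) {u v x : V} (hu : x ≠ u) (hv : x ≠ v) :
    (M.deleteEdge (u, v)).rot x = M.rot x := by
  simp [deleteEdge, hu, hv]

theorem deleteEdge_swap (M : RotationSystem V) {u v : V} (h : u ≠ v) :
    M.deleteEdge (v, u) = M.deleteEdge (u, v) := by
  refine RotationSystem.ext ?_ ?_
  · ext x y
    rw [deleteEdge_adj, deleteEdge_adj, Sym2.eq_swap (a := u)]
  · ext x : 1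
    by_cases hu : x = u
    · subst hu; rw [deleteEdge_rot_fst, deleteEdge_rot_snd _ h.symm]
    · by_cases hv : x = v
      · subst hv; rw [deleteEdge_rot_fst, deleteEdge_rot_snd _ h]
      · rw [deleteEdge_rot_of_ne _ hu hv, deleteEdge_rot_of_ne _ hv hu]

/-- The walk that would have entered the removed dart turns past it, onto the successor of the
reversed dart. -/
theorem facePerm_deleteEdge_of_eq (M : RotationSystem V) {u v : V} {p : V × V}
    (hp : M.facePerm p = (u, v)) : (M.deleteEdge (u, v)).facePerm p = M.facePerm (v, u) := by
  obtain ⟨a, b⟩ := p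
  simp only [facePerm_apply, Prod.mk.injEq] at hp ⊢
  obtain ⟨rfl, h⟩ := hp
  rw [deleteEdge_rot_fst, permErase_of_eq _ h]
  exact ⟨rfl, rfl⟩

theorem facePerm_deleteEdge_of_ne (M : RotationSystem V) {u v : V} {p : V × V}
    (h1 : p ≠ (u, v)) (h2 : p ≠ (v, u)) (h3 : M.facePerm p ≠ (u, v))
    (h4 : M.facePerm p ≠ (v, u)) : (M.deleteEdge (u, v)).facePerm p = M.facePerm p := by
  obtain ⟨a, b⟩ := p
  simp only [facePerm_apply, Prod.mk.injEq, ne_eq, true_and] at h1 h2 h3 h4 ⊢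
  by_cases hu : b = u
  · subst hu
    rw [deleteEdge_rot_fst, permErase_of_ne]
    · exact fun h => h2 ⟨h, rfl⟩
    · exact fun h => h3 ⟨rfl, h⟩
  · by_cases hv : b = v
    · subst hv
      rw [deleteEdge_rot_snd _ (Ne.symm hu), permErase_of_ne]
      · exact fun h => h1 ⟨h, rfl⟩
      · exact fun h => h4 ⟨rfl, h⟩
    · rw [deleteEdge_rot_of_ne _ hu hv]

theorem facePerm_deleteEdge_of_notMem (M : RotationSystem V) {u v : V} {p : V × V}
    (h1 : p ∉ M.faceOf (u, v)) (h2 : p ≠ (v, u)) (h3 : M.facePerm p ≠ (v, u)) :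
    (M.deleteEdge (u, v)).facePerm p = M.facePerm p := by
  refine M.facePerm_deleteEdge_of_ne ?_ h2 ?_ h3
  · rintro rfl; exact h1 (M.mem_faceOf_self _)
  · intro h4
    apply h1
    rw [← M.facePerm_mem_faceOf_iff, h4]
    exact M.mem_faceOf_self _

theorem deleteEdge_not_adj (M : RotationSystem V) (u v : V) :
    ¬ (M.deleteEdge (u, v)).graph.Adj u v := by
  rw [deleteEdge_adj]; simp

/-- The other faces are not affected by the removal of the edge. -/
theorem faceOf_deleteEdge_of_ne [Finite V] (M : RotationSystem V) {u v : V} {p : V × V}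
    (h1 : M.faceOf p ≠ M.faceOf (u, v)) (h2 : M.faceOf p ≠ M.faceOf (v, u)) :
    (M.deleteEdge (u, v)).faceOf p = M.faceOf p := by
  set N := M.deleteEdge (u, v)
  have hf : ∀ x ∈ M.faceOf p, N.facePerm x = M.facePerm x := by
    intro x hx
    have hx' := M.faceOf_eq_of_mem hx
    refine M.facePerm_deleteEdge_of_notMem ?_ ?_ ?_
    · intro h3
      exact h1 (hx'.symm.trans (M.faceOf_eq_of_mem h3))
    · rintro rfl; exact h2 hx'.symm
    · intro h3
      apply h2
      rw [← hx', ← M.faceOf_facePerm x, h3]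
  refine Set.Subset.antisymm (N.faceOf_subset_of_mapsTo ?_ (M.mem_faceOf_self p)) ?_
  · intro x hx
    rw [hf x hx]
    exact M.facePerm_mem_faceOf_iff.2 hx
  · have : M.faceOf p ⊆ {x | x ∈ M.faceOf p ∧ x ∈ N.faceOf p} := by
      refine M.faceOf_subset_of_mapsTo ?_ ⟨M.mem_faceOf_self p, N.mem_faceOf_self p⟩
      rintro x ⟨hx, hx'⟩
      refine ⟨M.facePerm_mem_faceOf_iff.2 hx, ?_⟩
      rw [← hf x hx]
      exact N.facePerm_mem_faceOf_iff.2 hx'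
    exact fun x hx => (this hx).2

namespace IsTriangle

/-- A triangular face is determined by the embedding without one of its edges. -/
theorem ext {M' : RotationSystem V} (h : M.IsTriangle u v z) (h' : M'.IsTriangle u v z)
    (he : M.deleteEdge (u, v) = M'.deleteEdge (u, v)) : M = M' := by
  -- The triangle tells where the edge was: `v` comes right after `z` around `u`, and `u` right
  -- before `z` around `v`.
  have key : ∀ {M : RotationSystem V}, M.IsTriangle u v z →
      M.rot u = permInsert ((M.deleteEdge (u, v)).rot u) v ((M.deleteEdge (u, v)).rot u z) ∧
      M.rot v = permInsert ((M.deleteEdge (u, v)).rot v) u z := by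
    intro M h
    constructor
    · rw [deleteEdge_rot_fst, permInsert_permErase h.rot_u]
    · rw [deleteEdge_rot_snd _ h.adj.ne, permErase, h.rot_v, permInsert, ← mul_assoc,
        Equiv.swap_mul_self, one_mul]
  refine RotationSystem.ext ?_ ?_
  · ext x y
    have h1 := M.deleteEdge_adj (u, v) (x := x) (y := y)
    have h2 := M'.deleteEdge_adj (u, v) (x := x) (y := y)
    rw [he] at h1
    have h3 := h1.symm.trans h2
    by_cases hxy : s(x, y) = s(u, v)
    · rw [← SimpleGraph.mem_edgeSet, ← SimpleGraph.mem_edgeSet, hxy]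
      exact ⟨fun _ => h'.adj, fun _ => h.adj⟩
    · simpa [hxy] using h3
  · ext x : 1
    by_cases hu : x = u
    · subst hu; rw [(key h).1, (key h').1, he]
    · by_cases hv : x = v
      · subst hv; rw [(key h).2, (key h').2, he]
      · rw [← M.deleteEdge_rot_of_ne hu hv, ← M'.deleteEdge_rot_of_ne hu hv, he]

theorem deleteEdge_facePerm_vz (h : M.IsTriangle u v z) :
    (M.deleteEdge (u, v)).facePerm (v, z) = (z, u) := by
  rw [facePerm_apply, M.deleteEdge_rot_of_ne h.adj_zu.ne h.adj_vz.ne.symm, h.rot_z]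

theorem deleteEdge_facePerm_zu (h : M.IsTriangle u v z) :
    (M.deleteEdge (u, v)).facePerm (z, u) = M.facePerm (v, u) :=
  M.facePerm_deleteEdge_of_eq h.facePerm_zu

theorem deleteEdge_facePerm_of_eq (h : M.IsTriangle u v z) {p : V × V}
    (hp : M.facePerm p = (v, u)) : (M.deleteEdge (u, v)).facePerm p = (v, z) := by
  rw [← M.deleteEdge_swap h.adj.ne, M.facePerm_deleteEdge_of_eq hp, h.facePerm_uv]

/-- The face that results from removing an edge of a triangular face. -/
theorem mergedFace_eq [Finite V] (h : M.IsTriangle u v z) :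
    (M.deleteEdge (u, v)).faceOf (v, z)
      = insert (v, z) (insert (z, u) (M.faceOf (v, u) \ {(v, u)})) := by
  set N := M.deleteEdge (u, v)
  refine Set.Subset.antisymm (N.faceOf_subset_of_mapsTo ?_ (Or.inl rfl)) ?_
  · rintro p (rfl | rfl | ⟨hp, hpv⟩)
    · rw [h.deleteEdge_facePerm_vz]; simp
    · rw [h.deleteEdge_facePerm_zu]
      refine Or.inr (Or.inr ⟨M.facePerm_mem_faceOf_iff.2 (M.mem_faceOf_self _), ?_⟩)
      simp [facePerm_apply, h.adj.ne]
    · by_cases hp' : M.facePerm p = (v, u)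
      · rw [h.deleteEdge_facePerm_of_eq hp']; simp
      · rw [M.facePerm_deleteEdge_of_notMem ?_ hpv hp']
        · exact Or.inr (Or.inr ⟨M.facePerm_mem_faceOf_iff.2 hp, hp'⟩)
        · intro hp2
          exact h.uv_notMem (Equiv.Perm.SameCycle.trans hp (Equiv.Perm.SameCycle.symm hp2))
  · have h1 := N.mem_faceOf_self (v, z)
    have h2 := N.facePerm_mem_faceOf_iff.2 h1
    rw [h.deleteEdge_facePerm_vz] at h2
    have h3 := N.facePerm_mem_faceOf_iff.2 h2
    rw [h.deleteEdge_facePerm_zu] at h3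
    have h4 : M.faceOf (v, u) ⊆ {p | p ∈ M.faceOf (v, u) ∧ (p = (v, u) ∨ p ∈ N.faceOf (v, z))} := by
      refine M.faceOf_subset_of_mapsTo ?_ ⟨M.mem_faceOf_self _, Or.inl rfl⟩
      rintro p ⟨hp, hp'⟩
      refine ⟨M.facePerm_mem_faceOf_iff.2 hp, ?_⟩
      by_cases hpv : p = (v, u)
      · subst hpv; exact Or.inr h3
      by_cases hp2 : M.facePerm p = (v, u)
      · exact Or.inl hp2
      right
      rw [← M.facePerm_deleteEdge_of_notMem ?_ hpv hp2]
      · exact N.facePerm_mem_faceOf_iff.2 (hp'.resolve_left hpv)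
      · intro hp3
        exact h.uv_notMem (Equiv.Perm.SameCycle.trans hp (Equiv.Perm.SameCycle.symm hp3))
    rintro p (rfl | rfl | ⟨hp, hpv⟩)
    · exact h1
    · exact h2
    · exact (h4 hp).2.resolve_left hpv

end IsTriangle

end

end RotationSystem

/-! ### Faces and planarity under removal -/

namespace RotationSystem

variable {V : Type*}

namespace IsTriangle

variable {M : RotationSystem V} {u v z : V}

theorem faceOf_ne [Finite V] (h : M.IsTriangle u v z) : M.faceOf (u, v) ≠ M.faceOf (v, u) :=
  fun he => h.vu_notMem (he ▸ M.mem_faceOf_self _)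

variable [DecidableEq V]

theorem deleteEdge_adj_vz (h : M.IsTriangle u v z) :
    (M.deleteEdge (u, v)).graph.Adj v z := by
  rw [deleteEdge_adj]
  refine ⟨h.adj_vz, ?_⟩
  have := h.adj_zu.ne
  have := h.adj.ne
  simp
  grind

theorem deleteEdge_adj_zu (h : M.IsTriangle u v z) :
    (M.deleteEdge (u, v)).graph.Adj z u := by
  have := (M.deleteEdge (u, v)).adj_facePerm_iff (p := (v, z)).2 h.deleteEdge_adj_vz
  rwa [h.deleteEdge_facePerm_vz] at this

/-- The path through `z` replaces the removed edge. -/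
theorem deleteEdge_connected_iff (h : M.IsTriangle u v z) :
    (M.deleteEdge (u, v)).graph.Connected ↔ M.graph.Connected := by
  constructor
  · intro hc
    exact hc.mono fun x y hxy => ((M.deleteEdge_adj _).1 hxy).1
  · intro hc
    have := hc.nonempty
    refine ⟨fun x y => ?_⟩
    have hr := (SimpleGraph.reachable_iff_reflTransGen _ _).1 (hc.preconnected x y)
    have huv : (M.deleteEdge (u, v)).graph.Reachable u v :=
      (h.deleteEdge_adj_vz.reachable.trans h.deleteEdge_adj_zu.reachable).symm
    induction hr with
    | refl => exact SimpleGraph.Reachable.refl _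
    | tail _ hab ih =>
      rename_i a b _
      refine ih.trans ?_
      by_cases he : s(a, b) = s(u, v)
      · rw [Sym2.eq_iff] at he
        rcases he with ⟨rfl, rfl⟩ | ⟨rfl, rfl⟩
        · exact huv
        · exact huv.symm
      · exact ((M.deleteEdge_adj (u, v)).2 ⟨hab, he⟩).reachable

variable [Finite V]

theorem mem_deleteEdge_faces_iff (h : M.IsTriangle u v z) {S : Set (V × V)} :
    S ∈ (M.deleteEdge (u, v)).faces ↔ S = (M.deleteEdge (u, v)).faceOf (v, z) ∨
      (S ∈ M.faces ∧ S ≠ M.faceOf (u, v) ∧ S ≠ M.faceOf (v, u)) := by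
  set N := M.deleteEdge (u, v) with hN
  constructor
  · rintro ⟨p, hp, rfl⟩
    have hadj := (M.deleteEdge_adj (u, v)).1 hp
    by_cases h1 : M.faceOf p = M.faceOf (u, v)
    · left
      apply N.faceOf_eq_of_mem
      rw [hN, h.mergedFace_eq]
      have hm : p ∈ M.faceOf (u, v) := h1 ▸ M.mem_faceOf_self p
      rw [h.faceOf_uv] at hm
      rcases hm with rfl | rfl | rfl
      · exact absurd rfl hadj.2
      · simp
      · simp
    by_cases h2 : M.faceOf p = M.faceOf (v, u)
    · left
      apply N.faceOf_eq_of_mem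
      rw [hN, h.mergedFace_eq]
      refine Or.inr (Or.inr ⟨h2 ▸ M.mem_faceOf_self p, ?_⟩)
      rintro rfl
      exact hadj.2 Sym2.eq_swap
    · right
      rw [M.faceOf_deleteEdge_of_ne h1 h2]
      exact ⟨M.faceOf_mem_faces hadj.1, h1, h2⟩
  · rintro (rfl | ⟨⟨p, hp, rfl⟩, h1, h2⟩)
    · exact N.faceOf_mem_faces h.deleteEdge_adj_vz
    · rw [← M.faceOf_deleteEdge_of_ne h1 h2]
      refine N.faceOf_mem_faces ((M.deleteEdge_adj _).2 ⟨hp, fun he => ?_⟩)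
      rw [Sym2.eq_iff] at he
      obtain ⟨a, b⟩ := p
      rcases he with ⟨rfl, rfl⟩ | ⟨rfl, rfl⟩
      · exact h1 rfl
      · exact h2 rfl

/-- The only face of `M` through the dart `(v, z)` is the triangle, and that contains the removed
dart `(u, v)`. -/
theorem mergedFace_notMem_faces (h : M.IsTriangle u v z) :
    (M.deleteEdge (u, v)).faceOf (v, z) ∉ M.faces := by
  intro hm
  have h1 := M.eq_faceOf_of_mem hm ((M.deleteEdge (u, v)).mem_faceOf_self (v, z))
  rw [← h.facePerm_uv, M.faceOf_facePerm, h.facePerm_uv] at h1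
  have h2 := M.mem_faceOf_self (u, v)
  rw [← h1] at h2
  exact deleteEdge_not_adj M u v ((M.deleteEdge (u, v)).adj_of_mem_faceOf h.deleteEdge_adj_vz h2)

theorem mem_faces_iff (h : M.IsTriangle u v z) {S : Set (V × V)} :
    S ∈ M.faces ↔ S = M.faceOf (u, v) ∨ S = M.faceOf (v, u) ∨
      (S ∈ (M.deleteEdge (u, v)).faces ∧ S ≠ (M.deleteEdge (u, v)).faceOf (v, z)) := by
  rw [h.mem_deleteEdge_faces_iff]
  constructor
  · intro hS
    by_cases h1 : S = M.faceOf (u, v)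
    · exact Or.inl h1
    by_cases h2 : S = M.faceOf (v, u)
    · exact Or.inr (Or.inl h2)
    refine Or.inr (Or.inr ⟨Or.inr ⟨hS, h1, h2⟩, ?_⟩)
    rintro rfl
    exact h.mergedFace_notMem_faces hS
  · rintro (rfl | rfl | ⟨h1 | h1, h2⟩)
    · exact M.faceOf_mem_faces h.adj
    · exact M.faceOf_mem_faces h.adj.symm
    · exact absurd h1 h2
    · exact h1.1

theorem ncard_deleteEdge_faces (h : M.IsTriangle u v z) :
    (M.deleteEdge (u, v)).faces.ncard + 1 = M.faces.ncard := by
  have e1 : (M.deleteEdge (u, v)).faces = insert ((M.deleteEdge (u, v)).faceOf (v, z))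
      (M.faces \ {M.faceOf (u, v), M.faceOf (v, u)}) := by
    ext S
    rw [h.mem_deleteEdge_faces_iff]
    simp [not_or]
  have hsub : {M.faceOf (u, v), M.faceOf (v, u)} ⊆ M.faces := by
    rintro S (rfl | rfl)
    · exact M.faceOf_mem_faces h.adj
    · exact M.faceOf_mem_faces h.adj.symm
  have h2 := Set.ncard_sdiff_add_ncard_of_subset hsub
  rw [Set.ncard_pair h.faceOf_ne] at h2
  rw [e1, Set.ncard_insert_of_notMem (fun hm => h.mergedFace_notMem_faces hm.1)]
  omega

theorem ncard_deleteEdge_edgeSet (h : M.IsTriangle u v z) :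
    (M.deleteEdge (u, v)).graph.edgeSet.ncard + 1 = M.graph.edgeSet.ncard := by
  have e1 : (M.deleteEdge (u, v)).graph.edgeSet = M.graph.edgeSet \ {s(u, v)} := by
    simp [deleteEdge]
  rw [e1]
  exact Set.ncard_sdiff_singleton_add_one h.adj

/-- Exactly one edge and one face are lost, and connectedness is unaffected. -/
theorem deleteEdge_isPlanar_iff (h : M.IsTriangle u v z) :
    (M.deleteEdge (u, v)).IsPlanar ↔ M.IsPlanar := by
  have h1 := h.ncard_deleteEdge_faces
  have h2 := h.ncard_deleteEdge_edgeSet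
  unfold IsPlanar
  rw [h.deleteEdge_connected_iff, ← h1, ← h2]
  refine and_congr_right fun _ => ?_
  omega

end IsTriangle

/-! ### Adding an edge that cuts off a triangle -/

section

variable [DecidableEq V]

/-- The embedding obtained by adding the edge `uv`, where `v`, `z`, `u` are consecutive vertices
of a face: the new edge cuts off the triangle with the corners `u`, `v`, `z`. -/
def insertEar (N : RotationSystem V) (u v z : V) (huv : u ≠ v) (hn : ¬ N.graph.Adj u v)
    (hvz : N.graph.Adj v z) (hzu : N.graph.Adj z u) : RotationSystem V where
  graph := N.graph ⊔ SimpleGraph.edge u v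
  rot x :=
    -- Around `u` the order becomes `z`, `v`, `N.rot u z`; around `v` the new neighbour `u`
    -- immediately precedes `z`.
    if x = u then permInsert (N.rot u) v (N.rot u z)
    else if x = v then permInsert (N.rot v) u z
    else N.rot x
  rot_isCycleOn x := by
    split_ifs with h1 h2
    · have e : (N.graph ⊔ SimpleGraph.edge u v).neighborSet x
          = insert v (N.graph.neighborSet u) := by
        subst h1; ext w; simp [SimpleGraph.edge_adj]; grind
      rw [e]
      exact permInsert_isCycleOn (N.rot_isCycleOn u) (N.rot_of_not_adj u v hn) hn
        (N.adj_rot_iff.2 hzu.symm)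
    · have e : (N.graph ⊔ SimpleGraph.edge u v).neighborSet x
          = insert u (N.graph.neighborSet v) := by
        subst h2; ext w; simp [SimpleGraph.edge_adj]; grind
      rw [e]
      exact permInsert_isCycleOn (N.rot_isCycleOn v)
        (N.rot_of_not_adj v u fun h => hn h.symm) (fun h => hn h.symm) hvz
    · have e : (N.graph ⊔ SimpleGraph.edge u v).neighborSet x = N.graph.neighborSet x := by
        ext w; simp [SimpleGraph.edge_adj]; grind
      rw [e]
      exact N.rot_isCycleOn x
  rot_of_not_adj x w h := by
    have hadj : ¬ N.graph.Adj x w := fun h' => h (Or.inl h')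
    have hfix := N.rot_of_not_adj x w hadj
    have hE : ¬ ((u = x ∧ v = w) ∨ (u = w ∧ v = x)) := by
      intro h'
      apply h
      right
      rw [SimpleGraph.edge_adj]
      grind
    split_ifs with h1 h2
    · subst h1
      have h3 : w ≠ v := by grind
      have h4 : w ≠ N.rot x z := by
        rintro rfl
        exact hadj (N.adj_rot_iff.2 hzu.symm)
      simp [permInsert, hfix, Equiv.swap_apply_of_ne_of_ne h3 h4]
    · subst h2
      have h3 : w ≠ u := by grind
      have h4 : w ≠ z := by
        rintro rfl
        exact hadj hvz
      simp [permInsert, hfix, Equiv.swap_apply_of_ne_of_ne h3 h4]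
    · exact hfix

section

variable (N : RotationSystem V) {u v z : V} (huv : u ≠ v) (hn : ¬ N.graph.Adj u v)
  (hvz : N.graph.Adj v z) (hzu : N.graph.Adj z u)

theorem insertEar_adj {x y : V} : (N.insertEar u v z huv hn hvz hzu).graph.Adj x y ↔
    N.graph.Adj x y ∨ s(x, y) = s(u, v) := by
  have : (N.insertEar u v z huv hn hvz hzu).graph = N.graph ⊔ SimpleGraph.edge u v := rfl
  rw [this, SimpleGraph.sup_adj, SimpleGraph.edge_adj, Sym2.eq_iff]
  grind

theorem insertEar_isTriangle (hr : N.rot z v = u) :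
    (N.insertEar u v z huv hn hvz hzu).IsTriangle u v z where
  adj := (N.insertEar_adj huv hn hvz hzu).2 (Or.inr rfl)
  rot_v := by
    have := N.rot_of_not_adj v u fun h => hn h.symm
    simp [insertEar, huv.symm, permInsert, this]
  rot_z := by
    simpa [insertEar, hzu.ne, hvz.ne.symm] using hr
  rot_u := by
    simp [insertEar, permInsert]

theorem deleteEdge_insertEar : (N.insertEar u v z huv hn hvz hzu).deleteEdge (u, v) = N := by
  refine RotationSystem.ext ?_ ?_
  · ext x y
    rw [deleteEdge_adj, insertEar_adj]
    constructor
    · rintro ⟨h1, h2⟩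
      exact h1.resolve_right h2
    · intro h
      refine ⟨Or.inl h, fun he => ?_⟩
      rw [Sym2.eq_iff] at he
      rcases he with ⟨rfl, rfl⟩ | ⟨rfl, rfl⟩
      · exact hn h
      · exact hn h.symm
  · ext x : 1
    by_cases hu : x = u
    · subst hu
      rw [deleteEdge_rot_fst]
      have : (N.insertEar x v z huv hn hvz hzu).rot x = permInsert (N.rot x) v (N.rot x z) := by
        simp [insertEar]
      rw [this, permErase_permInsert (N.rot_of_not_adj x v hn)]
    · by_cases hv : x = v
      · subst hv
        rw [deleteEdge_rot_snd _ huv]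
        have : (N.insertEar u x z huv hn hvz hzu).rot x = permInsert (N.rot x) u z := by
          simp [insertEar, hu]
        rw [this, permErase_permInsert (N.rot_of_not_adj x u fun h => hn h.symm)]
      · rw [deleteEdge_rot_of_ne _ hu hv]
        simp [insertEar, hu, hv]

end

end

end RotationSystem

/-! ### Opened 4-PPTs and the transfer of angles -/

/-- An embedding with tags that looks like a 4-PPT from which an edge between two interior faces
has been removed: the face `P` has four angles tagged convex. -/
structure IsOpened4PPT {V : Type*} (N : RotationSystem V) (outer R P : Set (V × V)) : Prop where
  isPlanar : N.IsPlanar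
  outer_mem : outer ∈ N.faces
  outer_subset : outer ⊆ R
  mem_faces : P ∈ N.faces
  ne_outer : P ≠ outer
  adj : ∀ p ∈ R, N.graph.Adj p.1 p.2
  three_convex : ∀ F ∈ N.faces, F ≠ outer → F ≠ P → (F \ R).ncard = 3
  ncard_le_four : ∀ F ∈ N.faces, F ≠ outer → F ≠ P → F.ncard ≤ 4
  four_convex : (P \ R).ncard = 4
  ncard_le_five : P.ncard ≤ 5
  pointed : ∀ x, ∃ p ∈ R, p.2 = x
  unique : ∀ p ∈ R, ∀ q ∈ R, p.2 = q.2 → p = q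

/-- The bijection between the angles outside the triangle `u`, `v`, `z` and the angles of the
embedding without the edge `uv`, extended to a permutation. -/
def angleSwap {V : Type*} [DecidableEq V] (u v z : V) : Equiv.Perm (V × V) :=
  Equiv.swap (v, u) (z, u)

section

variable {V : Type*} [DecidableEq V] {u v z : V}

theorem angleSwap_angleSwap (p : V × V) : angleSwap u v z (angleSwap u v z p) = p :=
  Equiv.swap_apply_self _ _ _

theorem angleSwap_vu : angleSwap u v z (v, u) = (z, u) := Equiv.swap_apply_left _ _

theorem angleSwap_zu : angleSwap u v z (z, u) = (v, u) := Equiv.swap_apply_right _ _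

theorem angleSwap_of_ne {p : V × V} (h1 : p ≠ (v, u)) (h2 : p ≠ (z, u)) :
    angleSwap u v z p = p := Equiv.swap_apply_of_ne_of_ne h1 h2

theorem angleSwap_snd (p : V × V) : (angleSwap u v z p).2 = p.2 := by
  by_cases h1 : p = (v, u)
  · subst h1; rw [angleSwap_vu]
  · by_cases h2 : p = (z, u)
    · subst h2; rw [angleSwap_zu]
    · rw [angleSwap_of_ne h1 h2]

theorem ncard_angleSwap_preimage (S : Set (V × V)) :
    (angleSwap u v z ⁻¹' S).ncard = S.ncard :=
  Set.ncard_preimage_of_injective_subset_range (angleSwap u v z).injective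
    (by rw [(angleSwap u v z).surjective.range_eq]; exact Set.subset_univ _)

theorem diff_angleSwap_preimage (S R : Set (V × V)) :
    (S \ (angleSwap u v z ⁻¹' R)).ncard = ((angleSwap u v z ⁻¹' S) \ R).ncard := by
  rw [← ncard_angleSwap_preimage (u := u) (v := v) (z := z) (S \ _)]
  congr 1
  ext p
  simp [angleSwap_angleSwap]

theorem preimage_angleSwap_involutive (R : Set (V × V)) :
    angleSwap u v z ⁻¹' (angleSwap u v z ⁻¹' R) = R := by
  ext p
  simp [angleSwap_angleSwap]

namespace RotationSystem.IsTriangle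

variable {M : RotationSystem V}

theorem angleSwap_of_mem_face (h : M.IsTriangle u v z) {F : Set (V × V)} (hF : F ∈ M.faces)
    (h1 : F ≠ M.faceOf (u, v)) (h2 : F ≠ M.faceOf (v, u)) {p : V × V} (hp : p ∈ F) :
    angleSwap u v z p = p := by
  refine angleSwap_of_ne ?_ ?_
  · rintro rfl
    exact h2 (M.eq_faceOf_of_mem hF hp)
  · rintro rfl
    apply h1
    rw [M.eq_faceOf_of_mem hF hp, ← M.faceOf_facePerm (z, u), h.facePerm_zu]

theorem diff_preimage_of_mem_face (h : M.IsTriangle u v z) {F : Set (V × V)} (hF : F ∈ M.faces)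
    (h1 : F ≠ M.faceOf (u, v)) (h2 : F ≠ M.faceOf (v, u)) (R : Set (V × V)) :
    F \ (angleSwap u v z ⁻¹' R) = F \ R := by
  ext p
  simp only [Set.mem_sdiff, Set.mem_preimage]
  exact and_congr_right fun hp => by rw [h.angleSwap_of_mem_face hF h1 h2 hp]

variable [Finite V]

/-- The dart `(v, u)` of the far face is replaced by `(z, u)`, which is what `angleSwap` does; `(v,
z)` is the one additional angle. In this form cardinalities transfer along a bijection. -/
theorem mergedFace_eq' (h : M.IsTriangle u v z) :
    (M.deleteEdge (u, v)).faceOf (v, z)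
      = insert (v, z) (angleSwap u v z ⁻¹' (M.faceOf (v, u))) := by
  have hzu : (z, u) ∉ M.faceOf (v, u) := by
    intro hm
    have := M.facePerm_mem_faceOf_iff.2 hm
    rw [h.facePerm_zu] at this
    exact h.uv_notMem this
  rw [h.mergedFace_eq]
  congr 1
  ext p
  by_cases h1 : p = (v, u)
  · subst h1
    have := h.adj_zu.ne
    have := h.adj_vz.ne
    simp [angleSwap_vu, hzu, this]
  · by_cases h2 : p = (z, u)
    · subst h2
      simp [angleSwap_zu, M.mem_faceOf_self]
    · simp [angleSwap_of_ne h1 h2, h1, h2]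

theorem vz_notMem_preimage (h : M.IsTriangle u v z) :
    (v, z) ∉ angleSwap u v z ⁻¹' (M.faceOf (v, u)) := by
  intro hm
  have n1 := h.adj_zu.ne
  have n2 := h.adj_vz.ne
  rw [Set.mem_preimage, angleSwap_of_ne (by simp [n1]) (by simp [n1]), ← h.facePerm_uv,
    M.facePerm_mem_faceOf_iff] at hm
  exact h.uv_notMem hm

theorem ncard_mergedFace (h : M.IsTriangle u v z) :
    ((M.deleteEdge (u, v)).faceOf (v, z)).ncard = (M.faceOf (v, u)).ncard + 1 := by
  rw [h.mergedFace_eq', Set.ncard_insert_of_notMem h.vz_notMem_preimage,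
    ncard_angleSwap_preimage]

theorem ncard_mergedFace_diff (h : M.IsTriangle u v z) {R : Set (V × V)} (hR : (v, z) ∉ R) :
    ((M.deleteEdge (u, v)).faceOf (v, z) \ R).ncard
      = (M.faceOf (v, u) \ (angleSwap u v z ⁻¹' R)).ncard + 1 := by
  rw [h.mergedFace_eq', Set.insert_sdiff_of_notMem _ hR, Set.ncard_insert_of_notMem,
    diff_angleSwap_preimage]
  exact fun hm => h.vz_notMem_preimage hm.1

end RotationSystem.IsTriangle

end

/-! ### Opening a 4-PPT and closing it again -/

namespace TaggedPlaneGraph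

variable {V : Type*} [Finite V] {u v z : V}

theorem Is4PPT.triangle_notMem_reflex {T : TaggedPlaneGraph V} (hT : T.Is4PPT)
    (h : T.IsTriangle u v z) (h1 : T.faceOf (u, v) ≠ T.outer) :
    ∀ p ∈ T.faceOf (u, v), p ∉ T.reflex := by
  have h2 := hT.isPseudoTriangulation.three_convex _ (T.faceOf_mem_faces h.adj) h1
  have h3 := Set.eq_of_subset_of_ncard_le (s := T.faceOf (u, v) \ T.reflex)
    Set.sdiff_subset (by rw [h2, h.ncard_faceOf_uv])
  intro p hp
  rw [← h3] at hp
  exact hp.2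

variable [DecidableEq V]

/-- At `v` the merged angle keeps the dart of the far face's angle; at `u` it is named `(z, u)` and
must receive the tag of `(v, u)`, whence `angleSwap`. As the triangle has no reflex angle, no reflex
tag is lost, and `(v, z)` is the fourth convex angle. -/
theorem Is4PPT.isOpened4PPT {T : TaggedPlaneGraph V} (hT : T.Is4PPT)
    (h : T.IsTriangle u v z) (h1 : T.faceOf (u, v) ≠ T.outer) (h2 : T.faceOf (v, u) ≠ T.outer) :
    IsOpened4PPT (T.deleteEdge (u, v)) T.outer (angleSwap u v z ⁻¹' T.reflex)
      ((T.deleteEdge (u, v)).faceOf (v, z)) ∧ (v, z) ∉ angleSwap u v z ⁻¹' T.reflex := by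
  have htri := hT.triangle_notMem_reflex h h1
  rw [h.faceOf_uv] at htri
  have hq : (v, z) ∉ angleSwap u v z ⁻¹' T.reflex := by
    have := h.adj_zu.ne
    rw [Set.mem_preimage, angleSwap_of_ne (by simp [this]) (by simp [this])]
    exact htri _ (by simp)
  obtain ⟨⟨p3, po, pu⟩, hpt, h4⟩ := hT
  have hne : (T.deleteEdge (u, v)).faceOf (v, z) ≠ T.outer :=
    fun he => h.mergedFace_notMem_faces (he ▸ T.outer_mem)
  have hother : ∀ F ∈ (T.deleteEdge (u, v)).faces, F ≠ (T.deleteEdge (u, v)).faceOf (v, z) →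
      F ∈ T.faces ∧ F ≠ T.faceOf (u, v) ∧ F ≠ T.faceOf (v, u) :=
    fun F hF hFP => (h.mem_deleteEdge_faces_iff.1 hF).resolve_left hFP
  refine ⟨⟨h.deleteEdge_isPlanar_iff.2 T.isPlanar, ?_, ?_, ?_, hne, ?_, ?_, ?_, ?_, ?_, ?_, ?_⟩, hq⟩
  · exact h.mem_deleteEdge_faces_iff.2 (Or.inr ⟨T.outer_mem, h1.symm, h2.symm⟩)
  · intro p hp
    rw [Set.mem_preimage, h.angleSwap_of_mem_face T.outer_mem h1.symm h2.symm hp]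
    exact po hp
  · exact RotationSystem.faceOf_mem_faces _ h.deleteEdge_adj_vz
  · intro p hp
    by_cases hp1 : p = (v, u)
    · subst hp1
      rw [Set.mem_preimage, angleSwap_vu] at hp
      exact absurd hp (htri _ (by simp))
    · by_cases hp2 : p = (z, u)
      · subst hp2; exact h.deleteEdge_adj_zu
      · rw [Set.mem_preimage, angleSwap_of_ne hp1 hp2] at hp
        rw [RotationSystem.deleteEdge_adj]
        refine ⟨T.adj_of_mem_reflex p hp, fun he => ?_⟩
        obtain ⟨a, b⟩ := p
        rw [Sym2.eq_iff] at he
        rcases he with ⟨rfl, rfl⟩ | ⟨rfl, rfl⟩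
        · exact htri _ (by simp) hp
        · exact hp1 rfl
  · intro F hF hFo hFP
    obtain ⟨hF1, hF2, hF3⟩ := hother F hF hFP
    rw [h.diff_preimage_of_mem_face hF1 hF2 hF3]
    exact p3 F hF1 hFo
  · intro F hF hFo hFP
    exact h4 F (hother F hF hFP).1 hFo
  · rw [h.ncard_mergedFace_diff hq, preimage_angleSwap_involutive,
      p3 _ (T.faceOf_mem_faces h.adj.symm) h2]
  · rw [h.ncard_mergedFace]
    have := h4 _ (T.faceOf_mem_faces h.adj.symm) h2
    omega
  · intro x
    obtain ⟨p, hp, rfl⟩ := hpt x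
    exact ⟨angleSwap u v z p, by simpa [angleSwap_angleSwap] using hp, angleSwap_snd p⟩
  · intro p hp q hq' hpq
    refine (angleSwap u v z).injective (pu _ hp _ hq' ?_)
    rw [angleSwap_snd, angleSwap_snd, hpq]

end TaggedPlaneGraph

/-- The converse of opening: cutting off the ear at the convex corner `z` spends one of the four
convex angles of `P`, so three remain in the other part, whose length is `P.ncard - 1`. -/
theorem IsOpened4PPT.exists_is4PPT {V : Type*} [Finite V] [DecidableEq V] {N : RotationSystem V}
    {outer R P : Set (V × V)} (h : IsOpened4PPT N outer R P) {u v z : V} (hP : (v, z) ∈ P)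
    (hR : (v, z) ∉ R) (hr : N.rot z v = u) (huv : u ≠ v) (hn : ¬ N.graph.Adj u v) :
    ∃ T : TaggedPlaneGraph V, T.Is4PPT ∧ T.IsTriangle u v z ∧ T.deleteEdge (u, v) = N ∧
      T.outer = outer ∧ T.reflex = angleSwap u v z ⁻¹' R := by
  have hvz : N.graph.Adj v z := N.adj_of_mem_face h.mem_faces hP
  have hzu : N.graph.Adj z u := hr ▸ N.adj_rot_iff.2 hvz.symm
  obtain ⟨M, hM, hMN⟩ : ∃ M : RotationSystem V, M.IsTriangle u v z ∧ M.deleteEdge (u, v) = N :=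
    ⟨N.insertEar u v z huv hn hvz hzu, N.insertEar_isTriangle huv hn hvz hzu hr,
      N.deleteEdge_insertEar huv hn hvz hzu⟩
  subst hMN
  have hPeq : P = (M.deleteEdge (u, v)).faceOf (v, z) :=
    RotationSystem.eq_faceOf_of_mem _ h.mem_faces hP
  subst hPeq
  -- The darts of the new edge are not darts of the opened embedding, so they carry no reflex tag;
  -- hence all three angles of the ear become convex.
  have hvuR : (v, u) ∉ R := fun hm => hn (h.adj _ hm).symm
  have huvR : (u, v) ∉ R := fun hm => hn (h.adj _ hm)
  have n1 := hM.adj.ne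
  have n2 := hM.adj_zu.ne
  have n3 := hM.adj_vz.ne
  have hout : outer ∈ M.faces ∧ outer ≠ M.faceOf (u, v) ∧ outer ≠ M.faceOf (v, u) :=
    (hM.mem_deleteEdge_faces_iff.1 h.outer_mem).resolve_left h.ne_outer.symm
  have htri : M.faceOf (u, v) \ angleSwap u v z ⁻¹' R = M.faceOf (u, v) := by
    rw [hM.faceOf_uv]
    refine Set.Subset.antisymm Set.sdiff_subset fun p hp => ⟨hp, ?_⟩
    rcases hp with rfl | rfl | rfl
    · rwa [Set.mem_preimage, angleSwap_of_ne (by simp [n1]) (by simp [n1.symm])]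
    · rwa [Set.mem_preimage, angleSwap_of_ne (by simp [n2]) (by simp [n2])]
    · rwa [Set.mem_preimage, angleSwap_zu]
  refine ⟨⟨M, hM.deleteEdge_isPlanar_iff.1 h.isPlanar, outer, hout.1, angleSwap u v z ⁻¹' R, ?_⟩,
    ⟨⟨?_, ?_, ?_⟩, ?_, ?_⟩, hM, rfl, rfl, rfl⟩
  · intro p hp
    by_cases hp1 : p = (v, u)
    · subst hp1; exact hM.adj.symm
    · by_cases hp2 : p = (z, u)
      · subst hp2; exact hM.adj_zu
      · rw [Set.mem_preimage, angleSwap_of_ne hp1 hp2] at hp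
        exact ((M.deleteEdge_adj _).1 (h.adj p hp)).1
  · intro F hF hFo
    change (F \ angleSwap u v z ⁻¹' R).ncard = 3
    by_cases h1 : F = M.faceOf (u, v)
    · rw [h1, htri, hM.ncard_faceOf_uv]
    by_cases h2 : F = M.faceOf (v, u)
    · have h3 := hM.ncard_mergedFace_diff hR
      rw [h.four_convex] at h3
      rw [h2]
      omega
    · rw [hM.diff_preimage_of_mem_face hF h1 h2]
      obtain ⟨h3, h4⟩ := ((hM.mem_faces_iff.1 hF).resolve_left h1).resolve_left h2
      exact h.three_convex F h3 hFo h4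
  · intro p hp
    change angleSwap u v z p ∈ R
    rw [hM.angleSwap_of_mem_face hout.1 hout.2.1 hout.2.2 hp]
    exact h.outer_subset hp
  · intro p hp q hq hpq
    refine (angleSwap u v z).injective (h.unique _ hp _ hq ?_)
    rw [angleSwap_snd, angleSwap_snd, hpq]
  · intro x
    obtain ⟨p, hp, rfl⟩ := h.pointed x
    refine ⟨angleSwap u v z p, ?_, angleSwap_snd p⟩
    change angleSwap u v z (angleSwap u v z p) ∈ R
    rwa [angleSwap_angleSwap]
  · intro F hF hFo
    by_cases h1 : F = M.faceOf (u, v)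
    · rw [h1, hM.ncard_faceOf_uv]; omega
    by_cases h2 : F = M.faceOf (v, u)
    · have h3 := hM.ncard_mergedFace
      have h4 := h.ncard_le_five
      rw [h2]
      omega
    · obtain ⟨h3, h4⟩ := ((hM.mem_faces_iff.1 hF).resolve_left h1).resolve_left h2
      exact h.ncard_le_four F h3 hFo h4

/-! ### Leaves and uniqueness of tags -/

namespace RotationSystem

variable {V : Type*} [Finite V]

theorem eq_of_leaf (N : RotationSystem V) {x y l : V} (hx : N.graph.Adj l x)
    (hl : N.rot l x = x) (hy : N.graph.Adj l y) : y = x :=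
  N.rot_induction l (Q := fun y => y = x) hx rfl (fun z _ hz => by rw [hz, hl]) hy

end RotationSystem

namespace IsOpened4PPT

variable {V : Type*} [Finite V] {N : RotationSystem V} {outer R R' P : Set (V × V)}

theorem adj_of_mem (h : IsOpened4PPT N outer R P) {x y : V} (hp : (x, y) ∈ P) :
    N.graph.Adj x y := N.adj_of_mem_face h.mem_faces hp

/-- A leaf has a single angle, and some angle at it must be reflex. -/
theorem leaf_mem (h : IsOpened4PPT N outer R P) {x l : V} (hx : N.graph.Adj x l)
    (hl : N.rot l x = x) : (x, l) ∈ R := by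
  obtain ⟨⟨y, l'⟩, hy, rfl⟩ := h.pointed l
  have := N.eq_of_leaf hx.symm hl (h.adj _ hy).symm
  simpa [← this] using hy

theorem ncard_inter_add_four (h : IsOpened4PPT N outer R P) : (P ∩ R).ncard + 4 = P.ncard := by
  rw [← Set.ncard_inter_add_ncard_sdiff_eq_ncard P R, h.four_convex]

theorem inter_eq_empty (h : IsOpened4PPT N outer R P) (h4 : P.ncard = 4) : P ∩ R = ∅ := by
  have := h.ncard_inter_add_four
  rw [← Set.ncard_eq_zero]
  omega

theorem exists_inter_eq_singleton (h : IsOpened4PPT N outer R P) (h5 : P.ncard = 5) :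
    ∃ p, P ∩ R = {p} := by
  have := h.ncard_inter_add_four
  exact Set.ncard_eq_one.1 (by omega)

/-- The tags of the big face are determined if it is a 4-face or if it has a leaf. -/
theorem tags_unique (h : IsOpened4PPT N outer R P) (h' : IsOpened4PPT N outer R' P)
    (hRR : ∀ p, p ∉ P → (p ∈ R ↔ p ∈ R'))
    (hP : P.ncard = 4 ∨ (P.ncard = 5 ∧ ∃ x l, (x, l) ∈ P ∧ N.rot l x = x)) : R = R' := by
  have key : P ∩ R = P ∩ R' := by
    rcases hP with h4 | ⟨h5, x, l, hx, hl⟩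
    · rw [h.inter_eq_empty h4, h'.inter_eq_empty h4]
    · obtain ⟨p, hp⟩ := h.exists_inter_eq_singleton h5
      obtain ⟨p', hp'⟩ := h'.exists_inter_eq_singleton h5
      have h1 : (x, l) ∈ P ∩ R := ⟨hx, h.leaf_mem (h.adj_of_mem hx) hl⟩
      have h2 : (x, l) ∈ P ∩ R' := ⟨hx, h'.leaf_mem (h.adj_of_mem hx) hl⟩
      rw [hp] at h1 ⊢
      rw [hp'] at h2 ⊢
      rw [← Set.mem_singleton_iff.1 h1, ← Set.mem_singleton_iff.1 h2]
  ext p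
  by_cases hp : p ∈ P
  · have h1 : p ∈ P ∩ R ↔ p ∈ P ∩ R' := by rw [key]
    simpa [hp] using h1
  · exact hRR p hp

end IsOpened4PPT

/-! ### Flips as cutting off ears -/

namespace TaggedPlaneGraph

variable {V : Type*} [DecidableEq V]

/-- `T'` arises from `T` by a flip of the edge `ab`, where the new edge `uv` cuts off the triangle
with the corners `u`, `v`, `z`. -/
structure IsEarFlip (T : TaggedPlaneGraph V) (a b : V) (T' : TaggedPlaneGraph V) (u v z : V) :
    Prop where
  is4PPT : T'.Is4PPT
  outer_eq : T'.outer = T.outer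
  reflex_iff : ∀ S ∈ T.faces, S ≠ T.faceOf (a, b) → S ≠ T.faceOf (b, a) →
    ∀ p ∈ S, (p ∈ T'.reflex ↔ p ∈ T.reflex)
  isTriangle : T'.IsTriangle u v z
  not_adj : ¬ T.graph.Adj u v
  deleteEdge_eq : T'.deleteEdge (u, v) = T.deleteEdge (a, b)
  mem_mergedFace : (v, z) ∈ T.mergedFace (a, b)

variable {T T' : TaggedPlaneGraph V} {a b c u v z : V}

theorem mergedFace_eq_faceOf (h : T.IsTriangle a b c) :
    T.mergedFace (a, b) = (T.deleteEdge (a, b)).faceOf (b, c) := by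
  rw [RotationSystem.mergedFace, h.facePerm_uv]

namespace IsEarFlip

theorem mergedFace_eq (hf : T.IsEarFlip a b T' u v z) :
    T'.mergedFace (u, v) = T.mergedFace (a, b) := by
  rw [mergedFace_eq_faceOf hf.isTriangle, hf.deleteEdge_eq]
  exact (RotationSystem.mem_faceOf_iff_eq _).1 hf.mem_mergedFace

theorem faceOf_eq (hf : T.IsEarFlip a b T' u v z) :
    (T'.deleteEdge (u, v)).faceOf (v, z) = T.mergedFace (a, b) := by
  rw [← hf.mergedFace_eq, mergedFace_eq_faceOf hf.isTriangle]

theorem eq_of_tags_eq {T₁ T₂ : TaggedPlaneGraph V} (h₁ : T.IsEarFlip a b T₁ u v z)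
    (h₂ : T.IsEarFlip a b T₂ u v z)
    (hR : angleSwap u v z ⁻¹' T₁.reflex = angleSwap u v z ⁻¹' T₂.reflex) : T₁ = T₂ := by
  have h1 := h₁.isTriangle.ext h₂.isTriangle (h₁.deleteEdge_eq.trans h₂.deleteEdge_eq.symm)
  have h2 : T₁.reflex = T₂.reflex := by
    rw [← preimage_angleSwap_involutive (u := u) (v := v) (z := z) T₁.reflex, hR,
      preimage_angleSwap_involutive]
  exact TaggedPlaneGraph.ext (congrArg _ h1) (congrArg _ h1)
    (h₁.outer_eq.trans h₂.outer_eq.symm) h2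

theorem adj_iff (hf : T.IsEarFlip a b T' u v z) {x y : V} :
    T'.graph.Adj x y ↔ (T.deleteEdge (a, b)).graph.Adj x y ∨ s(x, y) = s(u, v) := by
  rw [← hf.deleteEdge_eq, RotationSystem.deleteEdge_adj]
  by_cases h : s(x, y) = s(u, v)
  · simp only [h, or_true, iff_true]
    rw [← SimpleGraph.mem_edgeSet, h]
    exact hf.isTriangle.adj
  · simp [h]

theorem sym2_eq_of_graph_eq {T₁ T₂ : TaggedPlaneGraph V} {u' v' z' : V}
    (h₁ : T.IsEarFlip a b T₁ u v z) (h₂ : T.IsEarFlip a b T₂ u' v' z')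
    (hg : T₁.graph = T₂.graph) : s(u, v) = s(u', v') := by
  have h := h₁.isTriangle.adj
  rw [hg, h₂.adj_iff] at h
  refine h.resolve_left fun h3 => h₁.not_adj ?_
  exact ((T.deleteEdge_adj _).1 h3).1

variable [Finite V]

theorem uv_notMem (hf : T.IsEarFlip a b T' u v z) {S : Set (V × V)} (hS : S ∈ T.faces) :
    (u, v) ∉ S := fun hm => hf.not_adj (T.adj_of_mem_face hS hm)

theorem vu_notMem (hf : T.IsEarFlip a b T' u v z) {S : Set (V × V)} (hS : S ∈ T.faces) :
    (v, u) ∉ S := fun hm => hf.not_adj (T.adj_of_mem_face hS hm).symm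

theorem faceOf_uv_ne (hf : T.IsEarFlip a b T' u v z) {S : Set (V × V)} (hS : S ∈ T.faces) :
    T'.faceOf (u, v) ≠ S := fun he => hf.uv_notMem hS (he ▸ T'.mem_faceOf_self _)

theorem faceOf_vu_ne (hf : T.IsEarFlip a b T' u v z) {S : Set (V × V)} (hS : S ∈ T.faces) :
    T'.faceOf (v, u) ≠ S := fun he => hf.vu_notMem hS (he ▸ T'.mem_faceOf_self _)

theorem ncard_faceOf_vu (hf : T.IsEarFlip a b T' u v z) :
    (T'.faceOf (v, u)).ncard + 1 = (T.mergedFace (a, b)).ncard := by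
  rw [← hf.faceOf_eq, hf.isTriangle.ncard_mergedFace]

/-- `T` and `T'` open to the same embedding and the same big face, which makes their tags
comparable. The faces at the new edge are not outer because the outer face consists of old edges. -/
theorem isOpened4PPT (hf : T.IsEarFlip a b T' u v z) :
    IsOpened4PPT (T.deleteEdge (a, b)) T.outer (angleSwap u v z ⁻¹' T'.reflex)
      (T.mergedFace (a, b)) := by
  have := (hf.is4PPT.isOpened4PPT hf.isTriangle (hf.outer_eq ▸ hf.faceOf_uv_ne T.outer_mem)
    (hf.outer_eq ▸ hf.faceOf_vu_ne T.outer_mem)).1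
  rwa [hf.faceOf_eq, hf.deleteEdge_eq, hf.outer_eq] at this

/-- A face of the opened embedding other than the big one is a face of both `T` and `T'`, and both
angle bijections fix its angles. -/
theorem mem_reflex_iff (hf : T.IsEarFlip a b T' u v z) (hT : T.IsTriangle a b c) {p : V × V}
    (hp : (T.deleteEdge (a, b)).graph.Adj p.1 p.2) (hpP : p ∉ T.mergedFace (a, b)) :
    (p ∈ angleSwap u v z ⁻¹' T'.reflex ↔ p ∈ angleSwap a b c ⁻¹' T.reflex) := by
  set N := T.deleteEdge (a, b) with hN
  have hne : N.faceOf p ≠ T.mergedFace (a, b) := fun he => hpP (he ▸ N.mem_faceOf_self p)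
  have h1 := hT.mem_deleteEdge_faces_iff.1 (N.faceOf_mem_faces hp)
  rw [← mergedFace_eq_faceOf hT] at h1
  obtain ⟨h1, h2, h3⟩ := h1.resolve_left hne
  have h4 := hf.isTriangle.mem_deleteEdge_faces_iff (S := N.faceOf p)
  rw [hf.faceOf_eq, hf.deleteEdge_eq, ← hN] at h4
  obtain ⟨h5, h6, h7⟩ := (h4.1 (N.faceOf_mem_faces hp)).resolve_left hne
  have hm := N.mem_faceOf_self p
  rw [Set.mem_preimage, Set.mem_preimage, hf.isTriangle.angleSwap_of_mem_face h5 h6 h7 hm,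
    hT.angleSwap_of_mem_face h1 h2 h3 hm]
  exact hf.reflex_iff _ h1 h2 h3 p hm

theorem tags_eq (hf : T.IsEarFlip a b T' u v z) (hT : T.IsTriangle a b c)
    (hop : IsOpened4PPT (T.deleteEdge (a, b)) T.outer (angleSwap a b c ⁻¹' T.reflex)
      (T.mergedFace (a, b)))
    (hP : (T.mergedFace (a, b)).ncard = 4 ∨ ((T.mergedFace (a, b)).ncard = 5 ∧
      ∃ x l, (x, l) ∈ T.mergedFace (a, b) ∧ (T.deleteEdge (a, b)).rot l x = x)) :
    angleSwap u v z ⁻¹' T'.reflex = angleSwap a b c ⁻¹' T.reflex := by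
  refine hf.isOpened4PPT.tags_unique hop (fun p hp => ?_) hP
  by_cases hadj : (T.deleteEdge (a, b)).graph.Adj p.1 p.2
  · exact hf.mem_reflex_iff hT hadj hp
  · exact ⟨fun h => absurd (hf.isOpened4PPT.adj p h) hadj, fun h => absurd (hop.adj p h) hadj⟩

end IsEarFlip

/-- The third corner `z` of the new triangle locates the flip at a corner of the merged face, so
flips can be enumerated along its boundary walk. -/
theorem isFlip_iff [Finite V] (h : T.IsTriangle a b c) :
    T.IsFlip (a, b) T' ↔ ∃ u v z, T.IsEarFlip a b T' u v z := by
  constructor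
  · rintro ⟨h1, h2, h3, ⟨u, v⟩, h4, h5, h6, h7, h8, h9⟩
    obtain ⟨z, hz⟩ := RotationSystem.IsTriangle.of_ncard h4 h8
    refine ⟨u, v, z, h1, h2, h3, hz, h5, h6, ?_⟩
    rw [← h7, mergedFace_eq_faceOf hz]
    exact RotationSystem.mem_faceOf_self _ _
  · rintro ⟨u, v, z, hf⟩
    refine ⟨hf.is4PPT, hf.outer_eq, hf.reflex_iff, (u, v), hf.isTriangle.adj, hf.not_adj,
      hf.deleteEdge_eq, hf.mergedFace_eq, hf.isTriangle.ncard_faceOf_uv, ?_⟩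
    have h1 := hf.ncard_faceOf_vu
    rw [mergedFace_eq_faceOf h, h.ncard_mergedFace] at h1
    exact Nat.succ_injective h1

theorem exists_isEarFlip [Finite V] (h : T.IsTriangle a b c)
    (hop : IsOpened4PPT (T.deleteEdge (a, b)) T.outer (angleSwap a b c ⁻¹' T.reflex)
      (T.mergedFace (a, b)))
    (hP : (v, z) ∈ T.mergedFace (a, b)) (hR : (v, z) ∉ angleSwap a b c ⁻¹' T.reflex)
    (hr : (T.deleteEdge (a, b)).rot z v = u) (huv : u ≠ v) (hn : ¬ T.graph.Adj u v) :
    ∃ T', T.IsEarFlip a b T' u v z := by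
  obtain ⟨T', h1, h2, h3, h4, h5⟩ := hop.exists_is4PPT hP hR hr huv
    fun h' => hn ((T.deleteEdge_adj _).1 h').1
  refine ⟨T', h1, h4, ?_, h2, hn, h3, hP⟩
  intro S hS hS1 hS2 p hp
  have hSN : S ∈ (T'.deleteEdge (u, v)).faces := by
    rw [h3]
    exact h.mem_deleteEdge_faces_iff.2 (Or.inr ⟨hS, hS1, hS2⟩)
  have hSP : S ≠ (T'.deleteEdge (u, v)).faceOf (v, z) := by
    rw [h3, ← RotationSystem.eq_faceOf_of_mem _ hop.mem_faces hP, mergedFace_eq_faceOf h]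
    rintro rfl
    exact h.mergedFace_notMem_faces hS
  obtain ⟨h6, h7, h8⟩ := (h2.mem_deleteEdge_faces_iff.1 hSN).resolve_left hSP
  rw [h5, Set.mem_preimage, Set.mem_preimage, h2.angleSwap_of_mem_face h6 h7 h8 hp,
    h.angleSwap_of_mem_face hS hS1 hS2 hp]

end TaggedPlaneGraph

/-! ### Boundary walks of length four and five -/

namespace RotationSystem

variable {V : Type*}

theorem exists_pow_of_mem_face [Finite V] (N : RotationSystem V) {P : Set (V × V)}
    (hP : P ∈ N.faces) {q : V × V} (hq : q ∈ P) :
    (N.facePerm ^ P.ncard) q = q ∧ ∀ p, p ∈ P ↔ ∃ n < P.ncard, (N.facePerm ^ n) q = p := by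
  have hfin := Set.toFinite P
  have hc : N.facePerm.IsCycleOn (hfin.toFinset : Set (V × V)) := by
    rw [hfin.coe_toFinset, N.eq_faceOf_of_mem hP hq]; exact N.isCycleOn_faceOf _
  rw [Set.ncard_eq_toFinset_card _ hfin]
  refine ⟨hc.pow_card_apply (by simpa using hq), fun p => ⟨fun hp => ?_, ?_⟩⟩
  · exact hc.exists_pow_eq (by simpa using hq) (by simpa using hp)
  · rintro ⟨n, -, rfl⟩
    clear * - hP hq
    induction n with
    | zero => simpa using hq
    | succ n ih =>
      rw [pow_succ', Equiv.Perm.mul_apply]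
      exact N.facePerm_mem_face hP ih

/-- `P` is a 4-face with the boundary walk `p₀ p₁ p₂ p₃`. -/
structure IsQuadrangle (N : RotationSystem V) (P : Set (V × V)) (p₀ p₁ p₂ p₃ : V) : Prop where
  eq : P = {(p₃, p₀), (p₀, p₁), (p₁, p₂), (p₂, p₃)}
  rot₀ : N.rot p₀ p₃ = p₁
  rot₁ : N.rot p₁ p₀ = p₂
  rot₂ : N.rot p₂ p₁ = p₃
  rot₃ : N.rot p₃ p₂ = p₀

/-- `P` is a 5-face with the boundary walk `p₀ p₁ p₂ p₃ p₄`. -/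
structure IsPentagon (N : RotationSystem V) (P : Set (V × V)) (p₀ p₁ p₂ p₃ p₄ : V) : Prop where
  eq : P = {(p₄, p₀), (p₀, p₁), (p₁, p₂), (p₂, p₃), (p₃, p₄)}
  rot₀ : N.rot p₀ p₄ = p₁
  rot₁ : N.rot p₁ p₀ = p₂
  rot₂ : N.rot p₂ p₁ = p₃
  rot₃ : N.rot p₃ p₂ = p₄
  rot₄ : N.rot p₄ p₃ = p₀

theorem exists_isQuadrangle [Finite V] (N : RotationSystem V) {P : Set (V × V)}
    (hP : P ∈ N.faces) (h4 : P.ncard = 4) {x y : V} (hq : (x, y) ∈ P) :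
    ∃ p₁ p₂, N.IsQuadrangle P y p₁ p₂ x := by
  obtain ⟨h1, h2⟩ := N.exists_pow_of_mem_face hP hq
  rw [h4] at h1 h2
  simp only [pow_succ, pow_zero, one_mul, Equiv.Perm.mul_apply, facePerm_apply,
    Prod.mk.injEq] at h1
  refine ⟨_, _, ?_, rfl, rfl, h1.1, ?_⟩
  · ext p
    rw [h2]
    constructor
    · rintro ⟨n, hn, rfl⟩
      interval_cases n
      · simp
      · simp [facePerm_apply]
      · simp [pow_succ, facePerm_apply]
      · right; right; right
        simp [pow_succ, facePerm_apply, h1.1]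
    · rintro (rfl | rfl | rfl | rfl)
      · exact ⟨0, by omega, rfl⟩
      · exact ⟨1, by omega, rfl⟩
      · exact ⟨2, by omega, rfl⟩
      · exact ⟨3, by omega, by simp [pow_succ, facePerm_apply, h1.1]⟩
  · have := h1.2
    rwa [h1.1] at this

theorem exists_isPentagon [Finite V] (N : RotationSystem V) {P : Set (V × V)}
    (hP : P ∈ N.faces) (h5 : P.ncard = 5) {x y : V} (hq : (x, y) ∈ P) :
    ∃ p₁ p₂ p₃, N.IsPentagon P y p₁ p₂ p₃ x := by
  obtain ⟨h1, h2⟩ := N.exists_pow_of_mem_face hP hq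
  rw [h5] at h1 h2
  simp only [pow_succ, pow_zero, one_mul, Equiv.Perm.mul_apply, facePerm_apply,
    Prod.mk.injEq] at h1
  refine ⟨_, _, _, ?_, rfl, rfl, rfl, h1.1, ?_⟩
  · ext p
    rw [h2]
    constructor
    · rintro ⟨n, hn, rfl⟩
      interval_cases n
      · simp
      · simp [facePerm_apply]
      · simp [pow_succ, facePerm_apply]
      · simp [pow_succ, facePerm_apply]
      · right; right; right; right
        simp [pow_succ, facePerm_apply, h1.1]
    · rintro (rfl | rfl | rfl | rfl | rfl)
      · exact ⟨0, by omega, rfl⟩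
      · exact ⟨1, by omega, rfl⟩
      · exact ⟨2, by omega, rfl⟩
      · exact ⟨3, by omega, rfl⟩
      · exact ⟨4, by omega, by simp [pow_succ, facePerm_apply, h1.1]⟩
  · have := h1.2
    rwa [h1.1] at this

end RotationSystem

/-! ### Chords of the big face -/

namespace IsOpened4PPT

open RotationSystem

variable {V : Type*} {N : RotationSystem V} {outer R P : Set (V × V)}

/-- If two consecutive edges `uw`, `wv` of the big face and an edge `vu` form a triangle, and the
angle at `w` is convex, then the big face lies on the side of the triangle without the outer face,
it has five edges, and its reflex angle is neither at `u` nor at `v`. -/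
theorem exists_isRegion_of_chord [Fintype V] (h : IsOpened4PPT N outer R P) {u w v : V}
    (hq : (u, w) ∈ P) (hqR : (u, w) ∉ R) (hr : N.rot w u = v) (hvu : N.graph.Adj v u) :
    (∃ S, N.IsRegion S (triangleEdges u w v) ∧ P ⊆ S ∧ ∀ p ∈ P, p ∈ R → p.2 ≠ u ∧ p.2 ≠ v) ∧
      P.ncard ≠ 4 := by
  have huw := h.adj_of_mem hq
  have hwv : N.graph.Adj w v := hr ▸ N.adj_rot_iff.2 huw.symm
  obtain ⟨S, hS, hSo⟩ := N.exists_isRegion h.isPlanar huw hwv hvu h.outer_mem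
  have hPR := h.ncard_inter_add_four
  have hP5 := h.ncard_le_five
  have hother : ∀ F ∈ N.faces, F ⊆ S → F ≠ P → 2 * (F ∩ R).ncard + 2 ≤ F.ncard := by
    intro F hF hFS hFP
    have hFo : F ≠ outer := by
      rintro rfl
      obtain ⟨p, hp⟩ := N.nonempty_of_mem_faces hF
      exact hSo p hp (hFS hp)
    have h1 := h.three_convex F hF hFo hFP
    have h2 := h.ncard_le_four F hF hFo hFP
    have h3 := Set.ncard_inter_add_ncard_sdiff_eq_ncard F R
    omega
  -- The bound holds for `P` too: it has `P.ncard - 4` reflex angles and at most five edges.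
  have hX : ∀ F ∈ N.faces, F ⊆ S → 2 * (F ∩ R).ncard + 2 ≤ F.ncard := by
    intro F hF hFS
    by_cases hFP : F = P
    · subst hFP; omega
    · exact hother F hF hFS hFP
  have hcorner := fun p hp hc =>
    hS.corner_notMem h.isPlanar huw hwv hvu hX h.adj h.pointed (p := p) hp hc
  -- The reflex angle at `w` is not the corner angle `(u, w)`. If the latter were outside `S`, the
  -- former would be inside, contradicting `hcorner`.
  have hmem : (u, w) ∈ S := by
    by_contra hn
    obtain ⟨⟨x, w'⟩, hx, rfl⟩ := h.pointed w
    have hxu : x ≠ u := by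
      rintro rfl
      exact hqR hx
    exact hcorner _ hx (Or.inr (Or.inl rfl))
      ((hS.angle_mem_iff_of_corner huw hr hvu (h.adj _ hx).symm hxu).2 hn)
  have hPS : P ⊆ S := by
    rw [N.eq_faceOf_of_mem h.mem_faces hq]
    exact hS.faceOf_subset hmem
  refine ⟨⟨S, hS, hPS, fun p hpP hpR => ⟨fun he => ?_, fun he => ?_⟩⟩, fun h4 => ?_⟩
  · exact hcorner p hpR (Or.inl he) (hPS hpP)
  · exact hcorner p hpR (Or.inr (Or.inr he)) (hPS hpP)
  -- A 4-face without reflex angle still satisfies the bound when the convex angle `(u, w)` is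
  -- counted as reflex, and this angle is then a forbidden corner angle inside `S`.
  · refine hS.corner_notMem h.isPlanar huw hwv hvu (X := insert (u, w) R) ?_ ?_ ?_
      (p := (u, w)) (Or.inl rfl) (Or.inr (Or.inl rfl)) hmem
    · intro F hF hFS
      by_cases hFP : F = P
      · subst hFP
        rw [Set.inter_insert_of_mem hq, h.inter_eq_empty h4]
        simp [h4]
      · rw [Set.inter_insert_of_notMem]
        · exact hother F hF hFS hFP
        · intro hm
          apply hFP
          rw [N.eq_faceOf_of_mem hF hm, N.eq_faceOf_of_mem h.mem_faces hq]
    · rintro p (rfl | hp)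
      · exact huw
      · exact h.adj p hp
    · intro x
      obtain ⟨p, hp, hpx⟩ := h.pointed x
      exact ⟨p, Or.inr hp, hpx⟩

/-- If two opposite corners coincided, the corner between them would be a leaf, whose angle in `P`
is reflex; but `P` has no reflex angle. -/
theorem quadrangle_ne [Finite V] (h : IsOpened4PPT N outer R P) {p₀ p₁ p₂ p₃ : V}
    (hq : N.IsQuadrangle P p₀ p₁ p₂ p₃) (h4 : P.ncard = 4) : p₀ ≠ p₂ ∧ p₁ ≠ p₃ := by
  have h0 := h.inter_eq_empty h4
  constructor
  · rintro rfl
    have hm : (p₀, p₁) ∈ P := by rw [hq.eq]; simp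
    have : (p₀, p₁) ∈ P ∩ R := ⟨hm, h.leaf_mem (h.adj_of_mem hm) hq.rot₁⟩
    rwa [h0] at this
  · rintro rfl
    have hm : (p₁, p₂) ∈ P := by rw [hq.eq]; simp
    have : (p₁, p₂) ∈ P ∩ R := ⟨hm, h.leaf_mem (h.adj_of_mem hm) hq.rot₂⟩
    rwa [h0] at this

/-- The vertices of a big face of length five are distinct, unless the vertex of the reflex angle
is a leaf. -/
theorem pentagon_ne [Finite V] (h : IsOpened4PPT N outer R P) {p₀ p₁ p₂ p₃ p₄ : V}
    (hp : N.IsPentagon P p₀ p₁ p₂ p₃ p₄) (hR : P ∩ R = {(p₄, p₀)}) :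
    (p₀ ≠ p₁ ∧ p₁ ≠ p₂ ∧ p₂ ≠ p₃ ∧ p₃ ≠ p₄ ∧ p₄ ≠ p₀) ∧
    (p₀ ≠ p₂ ∧ p₁ ≠ p₃ ∧ p₂ ≠ p₄ ∧ p₃ ≠ p₀) := by
  have m0 : (p₄, p₀) ∈ P := by rw [hp.eq]; simp
  have m1 : (p₀, p₁) ∈ P := by rw [hp.eq]; simp
  have m2 : (p₁, p₂) ∈ P := by rw [hp.eq]; simp
  have m3 : (p₂, p₃) ∈ P := by rw [hp.eq]; simp
  have m4 : (p₃, p₄) ∈ P := by rw [hp.eq]; simp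
  -- Corners two steps apart coincide only around a leaf, and a leaf on `P` uses up the reflex
  -- angle, so it sits at `p₀`.
  have key : ∀ x l, (x, l) ∈ P → N.rot l x = x → x = p₄ ∧ l = p₀ := by
    intro x l hm hl
    have : (x, l) ∈ P ∩ R := ⟨hm, h.leaf_mem (h.adj_of_mem hm) hl⟩
    rw [hR] at this
    simpa using this
  have n0 := (h.adj_of_mem m0).ne
  have n1 := (h.adj_of_mem m1).ne
  have n2 := (h.adj_of_mem m2).ne
  have n3 := (h.adj_of_mem m3).ne
  have n4 := (h.adj_of_mem m4).ne
  have a1 : p₀ ≠ p₂ := by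
    rintro rfl
    exact n1 (key _ _ m1 hp.rot₁).2.symm
  have a2 : p₃ ≠ p₀ := by
    rintro rfl
    exact n0 (key _ _ m4 hp.rot₄).2
  refine ⟨⟨n1, n2, n3, n4, n0⟩, a1, ?_, ?_, a2⟩
  · rintro rfl
    exact a1 (key _ _ m2 hp.rot₂).2.symm
  · rintro rfl
    exact a2 (key _ _ m3 hp.rot₃).2

/-- The only coincidence of corners left open by `pentagon_ne` is `p₁ = p₄`, where the edge of the
leaf `p₀` is walked in both directions. -/
theorem isDegenerateFace_iff [Finite V] (h : IsOpened4PPT N outer R P) {p₀ p₁ p₂ p₃ p₄ : V}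
    (hp : N.IsPentagon P p₀ p₁ p₂ p₃ p₄) (hR : P ∩ R = {(p₄, p₀)}) :
    IsDegenerateFace P ↔ p₁ = p₄ := by
  obtain ⟨⟨n1, n2, n3, n4, n0⟩, a1, a2, a3, a4⟩ := h.pentagon_ne hp hR
  constructor
  · rintro ⟨⟨x, y⟩, hxy, hyx⟩
    rw [hp.eq] at hxy hyx
    simp only [Prod.swap, Set.mem_insert_iff, Set.mem_singleton_iff, Prod.mk.injEq] at hxy hyx
    grind
  · rintro rfl
    refine ⟨(p₁, p₀), ?_, ?_⟩ <;> rw [hp.eq] <;> simp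

/-- A chord that cuts off a convex corner cannot end at the reflex corner `p₀`. If `p₃p₁` is an
edge, `P` lies inside the triangle `p₁p₂p₃`, so an edge from the inner vertex `p₄` to `p₂` would run
inside as well; but the only angle at `p₂` inside is that of `P`. -/
theorem not_adj_of_pentagon [Fintype V] (h : IsOpened4PPT N outer R P) {p₀ p₁ p₂ p₃ p₄ : V}
    (hp : N.IsPentagon P p₀ p₁ p₂ p₃ p₄) (hR : P ∩ R = {(p₄, p₀)}) :
    ¬ N.graph.Adj p₂ p₀ ∧ ¬ N.graph.Adj p₀ p₃ ∧
      (p₁ ≠ p₄ → ¬ (N.graph.Adj p₃ p₁ ∧ N.graph.Adj p₄ p₂)) := by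
  obtain ⟨⟨n1, n2, n3, n4, n0⟩, a1, a2, a3, a4⟩ := h.pentagon_ne hp hR
  have m0 : (p₄, p₀) ∈ P ∩ R := by rw [hR]; rfl
  have m1 : (p₀, p₁) ∈ P := by rw [hp.eq]; simp
  have m2 : (p₁, p₂) ∈ P := by rw [hp.eq]; simp
  have m4 : (p₃, p₄) ∈ P := by rw [hp.eq]; simp
  have hnR : ∀ x y, (x, y) ∈ P → y ≠ p₀ → (x, y) ∉ R := by
    intro x y hm hy hmR
    have : (x, y) ∈ P ∩ R := ⟨hm, hmR⟩
    rw [hR] at this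
    simp [hy] at this
  refine ⟨fun hadj => ?_, fun hadj => ?_, fun hne ⟨hadj, hadj'⟩ => ?_⟩
  · obtain ⟨⟨S, -, -, hS⟩, -⟩ := h.exists_isRegion_of_chord m1 (hnR _ _ m1 n1.symm) hp.rot₁ hadj
    exact (hS _ m0.1 m0.2).1 rfl
  · obtain ⟨⟨S, -, -, hS⟩, -⟩ := h.exists_isRegion_of_chord m4 (hnR _ _ m4 n0) hp.rot₄ hadj
    exact (hS _ m0.1 m0.2).2 rfl
  · obtain ⟨⟨S, hS, hPS, -⟩, -⟩ :=
      h.exists_isRegion_of_chord m2 (hnR _ _ m2 a1.symm) hp.rot₂ hadj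
    have h1 : (p₂, p₄) ∈ S :=
      hS.angle_mem_of_interior (triangleEdges_off hne.symm a3.symm n4.symm) (hPS m4) hadj'
    have h2 : (p₄, p₂) ∈ S := by
      refine (hS.swap_mem_iff (p₂, p₄) hadj'.symm fun hm => ?_).2 h1
      exact triangleEdges_off hne.symm a3.symm n4.symm _ hm (Sym2.mem_mk_right _ _)
    exact (hS.angle_mem_iff_of_corner (h.adj_of_mem m2) hp.rot₂ hadj hadj'.symm hne.symm).1 h2
      (hPS m2)

end IsOpened4PPT

/-! ### Existence and number of flips -/

namespace TaggedPlaneGraph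

open RotationSystem

variable {V : Type*} [DecidableEq V] {T T' : TaggedPlaneGraph V} {a b c u v z : V}

theorem adj_iff_deleteEdge (h : T.graph.Adj a b) {x y : V} :
    T.graph.Adj x y ↔ (T.deleteEdge (a, b)).graph.Adj x y ∨ s(x, y) = s(a, b) := by
  rw [RotationSystem.deleteEdge_adj]
  by_cases he : s(x, y) = s(a, b)
  · simp only [he, or_true, iff_true]
    rw [← SimpleGraph.mem_edgeSet, he]
    exact h
  · simp [he]

theorem IsEarFlip.rot_eq (hf : T.IsEarFlip a b T' u v z) :
    (T.deleteEdge (a, b)).rot z v = u := by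
  have := hf.isTriangle.deleteEdge_facePerm_vz
  rw [hf.deleteEdge_eq, facePerm_apply] at this
  exact congrArg Prod.snd this

/-- If both sides of the new edge are triangles, then its two darts play the same role. -/
theorem IsEarFlip.symm [Finite V] (hf : T.IsEarFlip a b T' u v z)
    (h4 : (T.mergedFace (a, b)).ncard = 4) : ∃ z', T.IsEarFlip a b T' v u z' := by
  have h3 := hf.ncard_faceOf_vu
  obtain ⟨z', hz'⟩ := IsTriangle.of_ncard hf.isTriangle.adj.symm
    (show (T'.faceOf (v, u)).ncard = 3 by omega)
  refine ⟨z', hf.is4PPT, hf.outer_eq, hf.reflex_iff, hz', fun h => hf.not_adj h.symm, ?_, ?_⟩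
  · rw [T'.deleteEdge_swap hf.isTriangle.adj.ne, hf.deleteEdge_eq]
  · rw [← hf.faceOf_eq, hf.isTriangle.mergedFace_eq, hz'.faceOf_uv]
    have := hf.isTriangle.adj.ne
    simp [this]

/-- A flip in the situation of a 4-face, and its uniqueness. -/
theorem existsUnique_isFlip_of_quadrangle [Fintype V] (h : T.IsTriangle a b c)
    (hop : IsOpened4PPT (T.deleteEdge (a, b)) T.outer (angleSwap a b c ⁻¹' T.reflex)
      (T.mergedFace (a, b)))
    (hbc : (b, c) ∈ T.mergedFace (a, b)) (h4 : (T.mergedFace (a, b)).ncard = 4) :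
    ∃! T', T.IsFlip (a, b) T' := by
  obtain ⟨p₂, p₃, hq⟩ := exists_isQuadrangle _ hop.mem_faces h4 hbc
  have ha : (T.deleteEdge (a, b)).rot c b = a := by
    rw [T.deleteEdge_rot_of_ne h.adj_zu.ne h.adj_vz.ne.symm, h.rot_z]
  -- The removed edge is the diagonal from `p₂` to `b`; the candidate for the flip is the diagonal
  -- from `p₃` to `c`.
  obtain rfl : p₂ = a := hq.rot₀.symm.trans ha
  obtain ⟨n1, n2⟩ := hop.quadrangle_ne hq h4
  have m0 : (c, p₂) ∈ T.mergedFace (p₂, b) := by rw [hq.eq]; simp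
  have n3 := (hop.adj_of_mem m0).ne
  have n4 := (hop.adj_of_mem hbc).ne
  have hR := hop.inter_eq_empty h4
  have hnR : ∀ p ∈ T.mergedFace (p₂, b), p ∉ angleSwap p₂ b c ⁻¹' T.reflex := by
    intro p hp hpR
    have : p ∈ T.mergedFace (p₂, b) ∩ angleSwap p₂ b c ⁻¹' T.reflex := ⟨hp, hpR⟩
    rwa [hR] at this
  have hn : ¬ (T.deleteEdge (p₂, b)).graph.Adj p₃ c := fun hadj =>
    (hop.exists_isRegion_of_chord m0 (hnR _ m0) hq.rot₁ hadj).2 h4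
  have hn' : ¬ T.graph.Adj p₃ c := by
    rw [adj_iff_deleteEdge h.adj, not_or]
    refine ⟨hn, ?_⟩
    rw [Sym2.eq_iff]
    grind
  obtain ⟨T₁, hT₁⟩ := exists_isEarFlip h hop m0 (hnR _ m0) hq.rot₁ n1.symm hn'
  refine ⟨T₁, (isFlip_iff h).2 ⟨_, _, _, hT₁⟩, fun T₂ hT₂ => ?_⟩
  have fin : ∀ {T₂}, T.IsEarFlip p₂ b T₂ p₃ c p₂ → T₂ = T₁ := fun hT₂ =>
    hT₂.eq_of_tags_eq hT₁ ((hT₂.tags_eq h hop (Or.inl h4)).trans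
      (hT₁.tags_eq h hop (Or.inl h4)).symm)
  obtain ⟨u, v, z, hf⟩ := (isFlip_iff h).1 hT₂
  have hm := hf.mem_mergedFace
  have hr := hf.rot_eq
  rw [hq.eq] at hm
  simp only [Set.mem_insert_iff, Set.mem_singleton_iff, Prod.mk.injEq] at hm
  -- Ears at `c` and `p₃` would give back the removed edge; ears at `p₂` and `b` give the other
  -- diagonal through its two darts.
  rcases hm with ⟨rfl, rfl⟩ | ⟨rfl, rfl⟩ | ⟨rfl, rfl⟩ | ⟨rfl, rfl⟩
  · rw [hq.rot₀] at hr
    subst hr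
    exact absurd h.adj hf.not_adj
  · rw [hq.rot₁] at hr
    subst hr
    exact fin hf
  · rw [hq.rot₂] at hr
    subst hr
    exact absurd h.adj.symm hf.not_adj
  · rw [hq.rot₃] at hr
    subst hr
    obtain ⟨z', hf'⟩ := hf.symm h4
    have hm' := hf'.mem_mergedFace
    rw [hq.eq] at hm'
    simp only [Set.mem_insert_iff, Set.mem_singleton_iff, Prod.mk.injEq] at hm'
    obtain rfl : z' = p₂ := by grind
    exact fin hf'

/-- The flips whose new edge is a chord at the vertex with the reflex angle. -/
theorem exists_isEarFlip_of_pentagon [Fintype V] (h : T.IsTriangle a b c)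
    (hop : IsOpened4PPT (T.deleteEdge (a, b)) T.outer (angleSwap a b c ⁻¹' T.reflex)
      (T.mergedFace (a, b))) {p₀ p₁ p₂ p₃ p₄ : V}
    (hp : (T.deleteEdge (a, b)).IsPentagon (T.mergedFace (a, b)) p₀ p₁ p₂ p₃ p₄)
    (hR : T.mergedFace (a, b) ∩ angleSwap a b c ⁻¹' T.reflex = {(p₄, p₀)}) :
    (s(p₂, p₀) ≠ s(a, b) → ∃ T', T.IsEarFlip a b T' p₂ p₀ p₁) ∧
    (s(p₀, p₃) ≠ s(a, b) → ∃ T', T.IsEarFlip a b T' p₀ p₃ p₄) ∧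
    (p₁ ≠ p₄ → s(p₃, p₁) ≠ s(a, b) → s(p₄, p₂) ≠ s(a, b) →
      (∃ T', T.IsEarFlip a b T' p₃ p₁ p₂) ∨ ∃ T', T.IsEarFlip a b T' p₄ p₂ p₃) := by
  obtain ⟨⟨n1, n2, n3, n4, n0⟩, a1, a2, a3, a4⟩ := hop.pentagon_ne hp hR
  obtain ⟨c1, c2, c3⟩ := hop.not_adj_of_pentagon hp hR
  have hnR : ∀ x y, (x, y) ∈ T.mergedFace (a, b) → y ≠ p₀ →
      (x, y) ∉ angleSwap a b c ⁻¹' T.reflex := by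
    intro x y hm hy hmR
    have : (x, y) ∈ T.mergedFace (a, b) ∩ angleSwap a b c ⁻¹' T.reflex := ⟨hm, hmR⟩
    rw [hR] at this
    simp [hy] at this
  have hadj : ∀ {x y}, ¬ (T.deleteEdge (a, b)).graph.Adj x y → s(x, y) ≠ s(a, b) →
      ¬ T.graph.Adj x y := by
    intro x y h1 h2
    rw [adj_iff_deleteEdge h.adj, not_or]
    exact ⟨h1, h2⟩
  have m1 : (p₀, p₁) ∈ T.mergedFace (a, b) := by rw [hp.eq]; simp
  have m2 : (p₁, p₂) ∈ T.mergedFace (a, b) := by rw [hp.eq]; simp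
  have m3 : (p₂, p₃) ∈ T.mergedFace (a, b) := by rw [hp.eq]; simp
  have m4 : (p₃, p₄) ∈ T.mergedFace (a, b) := by rw [hp.eq]; simp
  refine ⟨fun hs => ?_, fun hs => ?_, fun hne hs2 hs3 => ?_⟩
  · exact exists_isEarFlip h hop m1 (hnR _ _ m1 n1.symm) hp.rot₁ a1.symm (hadj c1 hs)
  · exact exists_isEarFlip h hop m4 (hnR _ _ m4 n0) hp.rot₄ a4.symm (hadj c2 hs)
  · rcases not_and_or.1 (c3 hne) with c3 | c3
    · exact Or.inl (exists_isEarFlip h hop m2 (hnR _ _ m2 a1.symm) hp.rot₂ a2.symm (hadj c3 hs2))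
    · exact Or.inr (exists_isEarFlip h hop m3 (hnR _ _ m3 a4) hp.rot₃ a3.symm (hadj c3 hs3))

/-- If the removed edge ends at `p₀`, the other diagonal at `p₀` and one of `p₃p₁`, `p₄p₂` give
flips; otherwise both diagonals at `p₀` do. -/
theorem exists_two_isEarFlip_of_pentagon [Fintype V] (h : T.IsTriangle a b c)
    (hop : IsOpened4PPT (T.deleteEdge (a, b)) T.outer (angleSwap a b c ⁻¹' T.reflex)
      (T.mergedFace (a, b)))
    (hbc : (b, c) ∈ T.mergedFace (a, b)) (hbcR : (b, c) ∉ angleSwap a b c ⁻¹' T.reflex)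
    {p₀ p₁ p₂ p₃ p₄ : V}
    (hp : (T.deleteEdge (a, b)).IsPentagon (T.mergedFace (a, b)) p₀ p₁ p₂ p₃ p₄)
    (hR : T.mergedFace (a, b) ∩ angleSwap a b c ⁻¹' T.reflex = {(p₄, p₀)}) (hne : p₁ ≠ p₄) :
    ∃ T₁ T₂ : TaggedPlaneGraph V, T.IsFlip (a, b) T₁ ∧ T.IsFlip (a, b) T₂ ∧
      T₁.graph ≠ T₂.graph := by
  obtain ⟨⟨n1, n2, n3, n4, n0⟩, a1, a2, a3, a4⟩ := hop.pentagon_ne hp hR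
  obtain ⟨e1, e4, e23⟩ := exists_isEarFlip_of_pentagon h hop hp hR
  have ha : (T.deleteEdge (a, b)).rot c b = a := by
    rw [T.deleteEdge_rot_of_ne h.adj_zu.ne h.adj_vz.ne.symm, h.rot_z]
  have fin : ∀ {T₁ T₂ u v z u' v' z'}, T.IsEarFlip a b T₁ u v z → T.IsEarFlip a b T₂ u' v' z' →
      s(u, v) ≠ s(u', v') → ∃ T₁ T₂ : TaggedPlaneGraph V, T.IsFlip (a, b) T₁ ∧
        T.IsFlip (a, b) T₂ ∧ T₁.graph ≠ T₂.graph := fun h₁ h₂ hs =>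
    ⟨_, _, (isFlip_iff h).2 ⟨_, _, _, h₁⟩, (isFlip_iff h).2 ⟨_, _, _, h₂⟩,
      fun hg => hs (h₁.sym2_eq_of_graph_eq h₂ hg)⟩
  have hm := hbc
  rw [hp.eq] at hm
  simp only [Set.mem_insert_iff, Set.mem_singleton_iff, Prod.mk.injEq] at hm
  -- The removed edge cut off the corner at `c`, whose angle is convex, so this is not the reflex
  -- corner.
  have hbc0 : ¬ (b = p₄ ∧ c = p₀) := by
    rintro ⟨rfl, rfl⟩
    have h1 : (b, c) ∈ T.mergedFace (a, b) ∩ angleSwap a b c ⁻¹' T.reflex := by rw [hR]; rfl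
    exact hbcR h1.2
  rcases hm.resolve_left hbc0 with ⟨rfl, rfl⟩ | ⟨rfl, rfl⟩ | ⟨rfl, rfl⟩ | ⟨rfl, rfl⟩
  · obtain rfl := hp.rot₁.symm.trans ha
    obtain ⟨T₁, h₁⟩ := e4 (by rw [ne_eq, Sym2.eq_iff]; grind)
    rcases e23 hne (by rw [ne_eq, Sym2.eq_iff]; grind) (by rw [ne_eq, Sym2.eq_iff]; grind) with
      ⟨T₂, h₂⟩ | ⟨T₂, h₂⟩
    · exact fin h₁ h₂ (by rw [ne_eq, Sym2.eq_iff]; grind)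
    · exact fin h₁ h₂ (by rw [ne_eq, Sym2.eq_iff]; grind)
  · obtain rfl := hp.rot₂.symm.trans ha
    obtain ⟨T₁, h₁⟩ := e1 (by rw [ne_eq, Sym2.eq_iff]; grind)
    obtain ⟨T₂, h₂⟩ := e4 (by rw [ne_eq, Sym2.eq_iff]; grind)
    exact fin h₁ h₂ (by rw [ne_eq, Sym2.eq_iff]; grind)
  · obtain rfl := hp.rot₃.symm.trans ha
    obtain ⟨T₁, h₁⟩ := e1 (by rw [ne_eq, Sym2.eq_iff]; grind)
    obtain ⟨T₂, h₂⟩ := e4 (by rw [ne_eq, Sym2.eq_iff]; grind)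
    exact fin h₁ h₂ (by rw [ne_eq, Sym2.eq_iff]; grind)
  · obtain rfl := hp.rot₄.symm.trans ha
    obtain ⟨T₁, h₁⟩ := e1 (by rw [ne_eq, Sym2.eq_iff]; grind)
    rcases e23 hne (by rw [ne_eq, Sym2.eq_iff]; grind) (by rw [ne_eq, Sym2.eq_iff]; grind) with
      ⟨T₂, h₂⟩ | ⟨T₂, h₂⟩
    · exact fin h₁ h₂ (by rw [ne_eq, Sym2.eq_iff]; grind)
    · exact fin h₁ h₂ (by rw [ne_eq, Sym2.eq_iff]; grind)

/-- The leaf `p₀` hangs at `p₁` inside the triangle `p₁p₂p₃`, whose sides are edges. Only `p₀p₂` and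
`p₀p₃` can be drawn; one is the removed edge, the other the flip. -/
theorem existsUnique_isFlip_of_degenerate [Fintype V] (h : T.IsTriangle a b c)
    (hop : IsOpened4PPT (T.deleteEdge (a, b)) T.outer (angleSwap a b c ⁻¹' T.reflex)
      (T.mergedFace (a, b)))
    (hbc : (b, c) ∈ T.mergedFace (a, b)) (h5 : (T.mergedFace (a, b)).ncard = 5)
    {p₀ p₁ p₂ p₃ : V}
    (hp : (T.deleteEdge (a, b)).IsPentagon (T.mergedFace (a, b)) p₀ p₁ p₂ p₃ p₁)
    (hR : T.mergedFace (a, b) ∩ angleSwap a b c ⁻¹' T.reflex = {(p₁, p₀)}) :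
    ∃! T', T.IsFlip (a, b) T' := by
  obtain ⟨⟨n1, n2, n3, n4, n0⟩, a1, a2, a3, a4⟩ := hop.pentagon_ne hp hR
  obtain ⟨e1, e4, -⟩ := exists_isEarFlip_of_pentagon h hop hp hR
  have m0 : (p₁, p₀) ∈ T.mergedFace (a, b) := by rw [hp.eq]; simp
  have m2 : (p₁, p₂) ∈ T.mergedFace (a, b) := by rw [hp.eq]; simp
  have m4 : (p₃, p₁) ∈ T.mergedFace (a, b) := by rw [hp.eq]; simp
  have ha : (T.deleteEdge (a, b)).rot c b = a := by
    rw [T.deleteEdge_rot_of_ne h.adj_zu.ne h.adj_vz.ne.symm, h.rot_z]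
  have hab := RotationSystem.deleteEdge_not_adj T.toRotationSystem a b
  have hcase : ∀ {u v z}, (v, z) ∈ T.mergedFace (a, b) → (T.deleteEdge (a, b)).rot z v = u →
      u ≠ v → ¬ (T.deleteEdge (a, b)).graph.Adj u v →
      (u = p₂ ∧ v = p₀ ∧ z = p₁) ∨ (u = p₀ ∧ v = p₃ ∧ z = p₁) := by
    intro u v z hm hr huv hn
    rw [hp.eq] at hm
    simp only [Set.mem_insert_iff, Set.mem_singleton_iff, Prod.mk.injEq] at hm
    rcases hm with ⟨rfl, rfl⟩ | ⟨rfl, rfl⟩ | ⟨rfl, rfl⟩ | ⟨rfl, rfl⟩ | ⟨rfl, rfl⟩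
    · exact absurd (hr.symm.trans hp.rot₀) huv
    · exact Or.inl ⟨hr.symm.trans hp.rot₁, rfl, rfl⟩
    · obtain rfl := hp.rot₂.symm.trans hr
      exact absurd (hop.adj_of_mem m4) hn
    · obtain rfl := hp.rot₃.symm.trans hr
      exact absurd (hop.adj_of_mem m2) hn
    · exact Or.inr ⟨hr.symm.trans hp.rot₄, rfl, rfl⟩
  have hP : (T.mergedFace (a, b)).ncard = 4 ∨ ((T.mergedFace (a, b)).ncard = 5 ∧
      ∃ x l, (x, l) ∈ T.mergedFace (a, b) ∧ (T.deleteEdge (a, b)).rot l x = x) :=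
    Or.inr ⟨h5, p₁, p₀, m0, hp.rot₀⟩
  -- The primed ear is the removed edge and the unprimed one the flip; stated so, it serves both
  -- assignments of the two admissible ears.
  have key : ∀ {u v z u' v' z'}, a = u' → b = v' → (∃ T', T.IsEarFlip a b T' u v z) →
      (∀ {u₁ v₁ z₁}, (v₁, z₁) ∈ T.mergedFace (a, b) → (T.deleteEdge (a, b)).rot z₁ v₁ = u₁ →
        u₁ ≠ v₁ → ¬ (T.deleteEdge (a, b)).graph.Adj u₁ v₁ →
        (u₁ = u' ∧ v₁ = v' ∧ z₁ = z') ∨ (u₁ = u ∧ v₁ = v ∧ z₁ = z)) →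
      ∃! T', T.IsFlip (a, b) T' := by
    rintro u v z u' v' z' rfl rfl ⟨T₁, h₁⟩ hc
    refine ⟨T₁, (isFlip_iff h).2 ⟨_, _, _, h₁⟩, fun T₂ hT₂ => ?_⟩
    obtain ⟨u₁, v₁, z₁, h₂⟩ := (isFlip_iff h).1 hT₂
    have hn : ¬ (T.deleteEdge (a, b)).graph.Adj u₁ v₁ :=
      fun hadj => h₂.not_adj ((T.deleteEdge_adj _).1 hadj).1
    rcases hc h₂.mem_mergedFace h₂.rot_eq h₂.isTriangle.adj.ne hn with
      ⟨rfl, rfl, rfl⟩ | ⟨rfl, rfl, rfl⟩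
    · exact absurd h.adj h₂.not_adj
    · exact h₂.eq_of_tags_eq h₁ ((h₂.tags_eq h hop hP).trans (h₁.tags_eq h hop hP).symm)
  rcases hcase hbc ha h.adj.ne hab with ⟨ha, hb, -⟩ | ⟨ha, hb, -⟩
  · exact key ha hb (e4 (by rw [ha, hb, ne_eq, Sym2.eq_iff]; grind)) hcase
  · exact key ha hb (e1 (by rw [ha, hb, ne_eq, Sym2.eq_iff]; grind))
      fun h1 h2 h3 h4 => (hcase h1 h2 h3 h4).symm

end TaggedPlaneGraph

/-! ### Assembly of the cases -/

theorem mainTheorem6 {V : Type*} [Fintype V] [DecidableEq V]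
    (T : TaggedPlaneGraph V) (hT : T.Is4PPT)
    (d : V × V) (hd : T.graph.Adj d.1 d.2)
    (h_tri : (T.faceOf d).ncard = 3)
    (h_left : T.faceOf d ≠ T.outer) (h_right : T.faceOf d.swap ≠ T.outer) :
    T.IsFlippable d ∧
    (((T.mergedFace d).ncard = 4 ∨
        ((T.mergedFace d).ncard = 5 ∧ IsDegenerateFace (T.mergedFace d))) →
      ∃! T' : TaggedPlaneGraph V, T.IsFlip d T') ∧
    (((T.mergedFace d).ncard = 5 ∧ ¬ IsDegenerateFace (T.mergedFace d)) →
      ∃ T₁ T₂ : TaggedPlaneGraph V, T.IsFlip d T₁ ∧ T.IsFlip d T₂ ∧ T₁.graph ≠ T₂.graph) := by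
  obtain ⟨a, b⟩ := d
  obtain ⟨c, h⟩ := RotationSystem.IsTriangle.of_ncard (u := a) (v := b) hd h_tri
  obtain ⟨hop, hbcR⟩ := hT.isOpened4PPT h h_left h_right
  have hbc := (T.deleteEdge (a, b)).mem_faceOf_self (b, c)
  rw [← TaggedPlaneGraph.mergedFace_eq_faceOf h] at hop hbc
  -- Four convex angles and at most five angles in all leave only the sizes 4 and 5 for the merged
  -- face.
  have hsum := hop.ncard_inter_add_four
  have hle := hop.ncard_le_five
  have hpent : (T.mergedFace (a, b)).ncard = 5 →
      (IsDegenerateFace (T.mergedFace (a, b)) → ∃! T', T.IsFlip (a, b) T') ∧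
      (¬ IsDegenerateFace (T.mergedFace (a, b)) → ∃ T₁ T₂ : TaggedPlaneGraph V,
        T.IsFlip (a, b) T₁ ∧ T.IsFlip (a, b) T₂ ∧ T₁.graph ≠ T₂.graph) := by
    intro h5
    obtain ⟨⟨p₄, p₀⟩, hR⟩ := hop.exists_inter_eq_singleton h5
    have hm : (p₄, p₀) ∈ T.mergedFace (a, b) ∩ angleSwap a b c ⁻¹' T.reflex := by
      rw [hR]; rfl
    obtain ⟨p₁, p₂, p₃, hp⟩ := RotationSystem.exists_isPentagon _ hop.mem_faces h5 hm.1
    rw [hop.isDegenerateFace_iff hp hR]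
    constructor
    · rintro rfl
      exact TaggedPlaneGraph.existsUnique_isFlip_of_degenerate h hop hbc h5 hp hR
    · exact TaggedPlaneGraph.exists_two_isEarFlip_of_pentagon h hop hbc hbcR hp hR
  have hquad := TaggedPlaneGraph.existsUnique_isFlip_of_quadrangle h hop hbc
  refine ⟨?_, ?_, fun ⟨h5, hnd⟩ => (hpent h5).2 hnd⟩
  · by_cases h4 : (T.mergedFace (a, b)).ncard = 4
    · exact (hquad h4).exists
    · have h5 : (T.mergedFace (a, b)).ncard = 5 := by omega
      by_cases hdeg : IsDegenerateFace (T.mergedFace (a, b))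
      · exact ((hpent h5).1 hdeg).exists
      · obtain ⟨T₁, -, hT₁, -⟩ := (hpent h5).2 hdeg
        exact ⟨T₁, hT₁⟩
  · rintro (h4 | ⟨h5, hdeg⟩)
    · exact hquad h4
    · exact (hpent h5).1 hdeg
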